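/- **Theorem 1.** There is a polynomial-time approximation scheme (PTAS) for MinCKP. Here an instance of MinCKP consists of vectors $\mathbf p,\mathbf q,\mathbf c\in\mathbb{Q}_{\ge 0}^n$ and a rational number $C>0$, and asks to minimise $\mathbf c^\top \mathbf x$ over $\mathbf x\in\{0,1\}^n$ subject to $(\mathbf p^\top \mathbf x)^2+(\mathbf q^\top \mathbf x)^2\ge C$. More precisely, there are a single algorithm (a random access machine program, with logarithmic cost as its running time) and absolute constants $K,a,b\in\mathbb{N}$ such that, for every rational $\varepsilon>0$ and every feasible instance $(\mathbf p,\mathbf q,\mathbf c,C)$ with $n$ items, the algorithm, given $\varepsilon$ and the instance, halts after time at most $$K\cdot n^{2/\varepsilon+a}\cdot (L+\langle\varepsilon\rangle)^{b}$$ and outputs a vector $\mathbf x\in\{0,1\}^n$ with $(\mathbf p^\top \mathbf x)^2+(\mathbf q^\top \mathbf x)^2\ge C$ and $\mathbf c^\top \mathbf x\le(1+\varepsilon)\,\mathrm{OPT}$, where $\mathrm{OPT}$ is the minimum cost of a feasible 0/1-vector. Here $L$ and $\langle\varepsilon\rangle$ are the lengths of the binary representations of the instance and of $\varepsilon$. In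 particular, for every fixed $\varepsilon$ the running time is $n^{2/\varepsilon+O(1)}L^{O(1)}$. -/

import Mathlib

/-! ### Random access machine with logarithmic cost

The memory is an array of cells, addressed by integers and holding integers.  Every operation is
charged the binary length of the numbers (contents and addresses) that it handles. -/

namespace RAM

/-- Length of the binary representation of an integer, with one symbol for its sign. -/
def bits (z : ℤ) : ℕ := Nat.size z.natAbs + 1

/-- Contents of the memory. -/
abbrev Mem := ℤ → ℤ

/-- Arithmetic expressions; `cell e` is the content of the cell whose address is the value of `e`
(so `cell (const k)` is direct and `cell (cell (const k))` is indirect addressing). -/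
inductive Expr where
  | const (k : ℤ)
  | cell (addr : Expr)
  | add (e₁ e₂ : Expr)
  | sub (e₁ e₂ : Expr)
  | mul (e₁ e₂ : Expr)

/-- Value of an expression. -/
def Expr.eval (s : Mem) : Expr → ℤ
  | .const k => k
  | .cell e => s (e.eval s)
  | .add e₁ e₂ => e₁.eval s + e₂.eval s
  | .sub e₁ e₂ => e₁.eval s - e₂.eval s
  | .mul e₁ e₂ => e₁.eval s * e₂.eval s

/-- Logarithmic cost of evaluating an expression: every node is charged the binary length of its
value (the address of a `cell` and the operands of an operation are charged as nodes below). -/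
def Expr.cost (s : Mem) : Expr → ℕ
  | .const k => bits k
  | .cell e => e.cost s + bits (s (e.eval s))
  | .add e₁ e₂ => e₁.cost s + e₂.cost s + bits (e₁.eval s + e₂.eval s)
  | .sub e₁ e₂ => e₁.cost s + e₂.cost s + bits (e₁.eval s - e₂.eval s)
  | .mul e₁ e₂ => e₁.cost s + e₂.cost s + bits (e₁.eval s * e₂.eval s)

/-- Programs.  `store a e` writes the value of `e` into the cell with address the value of `a`;
the tests of `ite` and `loop` (a while loop) ask whether the value of the expression is
positive. -/
inductive Prog where
  | skip
  | store (a e : Expr)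
  | seq (c₁ c₂ : Prog)
  | ite (e : Expr) (c₁ c₂ : Prog)
  | loop (e : Expr) (c : Prog)

/-- `Exec c s t s'`: the program `c`, started with memory `s`, halts with memory `s'`, and the
run has total cost `t`. -/
inductive Exec : Prog → Mem → ℕ → Mem → Prop where
  | skip (s : Mem) : Exec .skip s 1 s
  | store (a e : Expr) (s : Mem) :
      Exec (.store a e) s (1 + a.cost s + e.cost s) (Function.update s (a.eval s) (e.eval s))
  | seq {c₁ c₂ : Prog} {s s₁ s₂ : Mem} {t₁ t₂ : ℕ} (h₁ : Exec c₁ s t₁ s₁)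
      (h₂ : Exec c₂ s₁ t₂ s₂) : Exec (.seq c₁ c₂) s (t₁ + t₂) s₂
  | ite_pos {e : Expr} {c₁ c₂ : Prog} {s s' : Mem} {t : ℕ} (he : 0 < e.eval s)
      (h : Exec c₁ s t s') : Exec (.ite e c₁ c₂) s (1 + e.cost s + t) s'
  | ite_neg {e : Expr} {c₁ c₂ : Prog} {s s' : Mem} {t : ℕ} (he : ¬ 0 < e.eval s)
      (h : Exec c₂ s t s') : Exec (.ite e c₁ c₂) s (1 + e.cost s + t) s'
  | loop_done {e : Expr} {c : Prog} {s : Mem} (he : ¬ 0 < e.eval s) :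
      Exec (.loop e c) s (1 + e.cost s) s
  | loop_step {e : Expr} {c : Prog} {s s₁ s₂ : Mem} {t₁ t₂ : ℕ} (he : 0 < e.eval s)
      (h₁ : Exec c s t₁ s₁) (h₂ : Exec (.loop e c) s₁ t₂ s₂) :
      Exec (.loop e c) s (1 + e.cost s + t₁ + t₂) s₂

/-- Memory that holds the list `l` in the cells `0, 1, 2, …` and `0` everywhere else. -/
def load (l : List ℤ) : Mem := fun z => if 0 ≤ z then l.getD z.toNat 0 else 0

/-- Length of the binary representation of a list of integers. -/
def bitLength (l : List ℤ) : ℕ := (l.map bits).sum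

end RAM

/-! ### The problem MinCKP -/

namespace MinCKP

/-- An instance of MinCKP with `n` items: minimise `c · x` over `x ∈ {0,1}ⁿ` subject to
`(p · x)² + (q · x)² ≥ C`. -/
structure Instance (n : ℕ) where
  p : Fin n → ℚ
  q : Fin n → ℚ
  c : Fin n → ℚ
  C : ℚ
  p_nonneg : ∀ i, 0 ≤ p i
  q_nonneg : ∀ i, 0 ≤ q i
  c_nonneg : ∀ i, 0 ≤ c i
  C_pos : 0 < C

/-- `v · x` for a 0/1-vector `x`. -/
def dot {n : ℕ} (v : Fin n → ℚ) (x : Fin n → Bool) : ℚ := ∑ i, v i * ((x i).toNat : ℚ)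

namespace Instance

variable {n : ℕ}

/-- The 0/1-vector `x` satisfies the constraint. -/
def Feasible (I : Instance n) (x : Fin n → Bool) : Prop :=
  I.C ≤ dot I.p x ^ 2 + dot I.q x ^ 2

/-- The cost of a 0/1-vector. -/
def cost (I : Instance n) (x : Fin n → Bool) : ℚ := dot I.c x

/-- `v` is the value of an optimal solution. -/
def IsOpt (I : Instance n) (v : ℚ) : Prop := IsLeast {w | ∃ y, I.Feasible y ∧ I.cost y = w} v

/-- `x` is feasible and its cost is at most `(1 + ε) · OPT`. -/
def EpsOptimal (I : Instance n) (ε : ℚ) (x : Fin n → Bool) : Prop :=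
  I.Feasible x ∧ ∃ v, I.IsOpt v ∧ I.cost x ≤ (1 + ε) * v

/-- The instance as a list of integers: `n`, then `C` and, item by item, the entries of `p`, `q`
and `c`, each rational as its numerator and denominator in lowest terms. -/
def encode (I : Instance n) : List ℤ :=
  [(n : ℤ), I.C.num, (I.C.den : ℤ)] ++
    (List.finRange n).flatMap fun i =>
      [(I.p i).num, ((I.p i).den : ℤ), (I.q i).num, ((I.q i).den : ℤ),
        (I.c i).num, ((I.c i).den : ℤ)]

end Instance

/-- A rational number as a list of two integers. -/
def encodeRat (ε : ℚ) : List ℤ := [ε.num, (ε.den : ℤ)]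

/-- The memory `s` holds the 0/1-vector `x` in the cells `0, …, n - 1`. -/
def Holds {n : ℕ} (s : RAM.Mem) (x : Fin n → Bool) : Prop :=
  ∀ i : Fin n, s ((i : ℕ) : ℤ) = ((x i).toNat : ℤ)

end MinCKP

/-!
The scheme rests on the fact that the length of a vector is its largest component over all
directions.  Let `O` be an optimal solution and `u` its vector `(p · x, q · x)`.  By the
Cauchy–Schwarz inequality every set that reaches at least as far as `O` in the direction `u` is
feasible, so one would like to solve the knapsack covering problem with the values
`u₁ p_k + u₂ q_k`.  If the `m = min (n, ⌈1 / ε⌉)` most expensive items of `O` are taken by force and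
more expensive ones are excluded from the rest, the greedy algorithm in the order of decreasing
density exceeds the optimum by at most one item that is cheaper than each of the `m` forced ones,
that is, by at most `ε · OPT` (`Scaled.exists_candidate`).

The direction `u` is unknown, but only the order of the densities matters, and it changes only at
the directions in which two items have equal density.  If `d` and `e` are the two such critical
directions adjacent to `u`, then `d + e` orders the items as `u` does, up to ties of `u`
(`exists_critical_sum`).  Two auxiliary items, the unit vectors at cost zero, make the axes
critical, so that adjacent critical directions exist.  Hence a candidate is described by `m + 6`
indices below `n + 2`: four for the two critical directions, one for the last item of the greedy
prefix, one for the bound on the costs, and `m` for the forced items.  The algorithm scales the data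
to integers by the product of all denominators, runs through all index tuples with an odometer, and
keeps the cheapest feasible candidate; only the existence of a good candidate has to be proved,
since each one is tested for feasibility.  The number of tuples is
`(n + 2) ^ (m + 6) ≤ 9 · 3 ^ 6 · n ^ (m + 6)`, because `m ≤ n` and `(1 + 2 / n) ^ n ≤ e ^ 2 ≤ 9`.

The run of the program is analysed with Hoare triples `RAM.Runs` that count elementary steps.  As
all cells stay bounded by a number `M` of length linear in that of the input, one step costs at most
a constant number of words of length `RAM.width M`.
-/

/-! ### Directions in the plane -/

namespace MinCKP

/-- Cross product of two vectors of the plane. -/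
def cross (u v : ℤ × ℤ) : ℤ := u.1 * v.2 - u.2 * v.1

/-- A monotone parametrisation of the directions in the closed first quadrant. -/
def slope (u : ℤ × ℤ) : ℚ := u.2 / (u.1 + u.2)

/-- The nonzero vectors of the closed first quadrant. -/
def InQuadrant (u : ℤ × ℤ) : Prop := 0 ≤ u.1 ∧ 0 ≤ u.2 ∧ 0 < u.1 + u.2

theorem slope_lt_slope {u v : ℤ × ℤ} (hu : InQuadrant u) (hv : InQuadrant v) :
    slope u < slope v ↔ 0 < cross u v := by
  obtain ⟨-, -, hu⟩ := hu
  obtain ⟨-, -, hv⟩ := hv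
  have hu' : (0 : ℚ) < u.1 + u.2 := by exact_mod_cast hu
  have hv' : (0 : ℚ) < v.1 + v.2 := by exact_mod_cast hv
  rw [slope, slope, div_lt_div_iff₀ hu' hv', cross]
  have : ((u.2 : ℚ) * (v.1 + v.2) < v.2 * (u.1 + u.2)) ↔
      (u.2 * (v.1 + v.2) < v.2 * (u.1 + u.2)) := by norm_cast
  rw [this]
  constructor <;> intro h <;> linarith

theorem slope_le_slope {u v : ℤ × ℤ} (hu : InQuadrant u) (hv : InQuadrant v) :
    slope u ≤ slope v ↔ 0 ≤ cross u v := by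
  rw [← not_lt, slope_lt_slope hv hu, cross, cross]
  constructor <;> intro h <;> linarith

/-- Let `Γ` be a finite set of critical vectors, symmetric and meeting both axes, and `u` a
direction of the first quadrant.  The sum of the two critical vectors adjacent to `u` on either
side lies on the same side as `u` of every critical line that does not contain `u`. -/
theorem exists_critical_sum (Γ : Finset (ℤ × ℤ)) (hneg : ∀ g ∈ Γ, -g ∈ Γ)
    (hx : ∃ a, 0 < a ∧ (a, 0) ∈ Γ) (hy : ∃ a, 0 < a ∧ (0, a) ∈ Γ) {u : ℤ × ℤ}
    (hu : InQuadrant u) :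
    ∃ d ∈ Γ, ∃ e ∈ Γ, ∀ g ∈ Γ, 0 < cross u g → 0 < cross (d + e) g := by
  classical
  obtain ⟨a, ha, hax⟩ := hx
  obtain ⟨b, hb, hby⟩ := hy
  have hqa : InQuadrant (a, 0) := ⟨ha.le, le_rfl, by simpa using ha⟩
  have hqb : InQuadrant (0, b) := ⟨le_rfl, hb.le, by simpa using hb⟩
  obtain ⟨d, hd, hdmax⟩ := Finset.exists_max_image
    (Γ.filter fun g => InQuadrant g ∧ slope g ≤ slope u) slope
    ⟨(a, 0), Finset.mem_filter.2 ⟨hax, hqa, (slope_le_slope hqa hu).2 (by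
      simpa [cross] using mul_nonneg ha.le hu.2.1)⟩⟩
  obtain ⟨e, he, hemin⟩ := Finset.exists_min_image
    (Γ.filter fun g => InQuadrant g ∧ slope u ≤ slope g) slope
    ⟨(0, b), Finset.mem_filter.2 ⟨hby, hqb, (slope_le_slope hu hqb).2 (by
      simpa [cross] using mul_nonneg hu.1 hb.le)⟩⟩
  simp only [Finset.mem_filter] at hd he hdmax hemin
  obtain ⟨hdΓ, hdq, hdu⟩ := hd
  obtain ⟨heΓ, heq, heu⟩ := he
  refine ⟨d, hdΓ, e, heΓ, fun g hg hug => ?_⟩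
  have hsum : cross (d + e) g = cross d g + cross e g := by simp [cross]; ring
  rw [hsum]
  by_cases h1 : InQuadrant g
  · have hlt := (slope_lt_slope hu h1).2 hug
    have h2 := (slope_lt_slope hdq h1).1 (hdu.trans_lt hlt)
    have h3 := (slope_le_slope heq h1).1 (hemin g ⟨hg, h1, hlt.le⟩)
    linarith
  by_cases h2 : InQuadrant (-g)
  · have hc : ∀ v, cross v g = cross (-g) v := fun v => by simp [cross]; ring
    rw [hc] at hug ⊢
    rw [hc]
    have hlt := (slope_lt_slope h2 hu).2 hug
    have h3 := (slope_lt_slope h2 heq).1 (hlt.trans_le heu)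
    have h4 := (slope_le_slope h2 hdq).1 (hdmax (-g) ⟨hneg g hg, h2, hlt.le⟩)
    linarith
  · -- `g` lies in the open second quadrant, on the same side of all of the first quadrant
    have key : g.1 < 0 ∧ 0 < g.2 := by
      simp only [InQuadrant, not_and, not_lt, Prod.fst_neg, Prod.snd_neg] at h1 h2
      obtain ⟨hu1, hu2, hu3⟩ := hu
      simp only [cross] at hug
      rcases lt_trichotomy g.1 0 with h | h | h
      · refine ⟨h, ?_⟩
        by_contra h'
        have := h2 (by linarith) (by linarith)
        linarith
      · rw [h] at hug h1 h2
        rcases le_total 0 g.2 with h' | h'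
        · have := h1 le_rfl h'
          have h0 : g.2 = 0 := by linarith
          simp [h0] at hug
        · nlinarith
      · have h' : g.2 < 0 := by
          by_contra h'
          have := h1 h.le (by linarith)
          linarith
        nlinarith
    have pos : ∀ v, InQuadrant v → 0 < cross v g := by
      rintro v ⟨h1, h2, h3⟩
      simp only [cross]
      rcases h1.eq_or_lt with h | h
      · rw [← h] at h3 ⊢
        nlinarith [key.1, key.2]
      · nlinarith [mul_pos h key.2, mul_nonneg h2 (neg_nonneg.2 key.1.le)]
    linarith [pos d hdq, pos e heq]

/-! ### The candidate solutions -/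

/-- An instance with integral data, together with the number `m` of items that are guessed.
The items are `0, …, n - 1`; the indices `n` and `n + 1` carry two auxiliary vectors. -/
structure Scaled where
  n : ℕ
  m : ℕ
  p : ℕ → ℤ
  q : ℕ → ℤ
  c : ℕ → ℤ
  thr : ℤ
  den : ℤ

namespace Scaled

variable (D : Scaled)

/-- The data are nonnegative, and the auxiliary indices `n` and `n + 1` carry the unit vectors at
cost zero; these make the two axes critical directions. -/
structure Proper : Prop where
  p_nonneg : ∀ k, 0 ≤ D.p k
  q_nonneg : ∀ k, 0 ≤ D.q k
  c_nonneg : ∀ k, 0 ≤ D.c k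
  p_n : D.p D.n = 0
  q_n : D.q D.n = 1
  c_n : D.c D.n = 0
  p_n1 : D.p (D.n + 1) = 1
  q_n1 : D.q (D.n + 1) = 0
  c_n1 : D.c (D.n + 1) = 0

/-- First coordinate of the direction in which the items `i` and `j` have the same density. -/
def dirX (i j : ℕ) : ℤ := D.c i * D.q j - D.c j * D.q i

/-- Second coordinate of the direction in which the items `i` and `j` have the same density. -/
def dirY (i j : ℕ) : ℤ := D.c j * D.p i - D.c i * D.p j

/-- Value of the item `k` in the direction `(x, y)`. -/
def gain (x y : ℤ) (k : ℕ) : ℤ := x * D.p k + y * D.q k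

/-- This is positive when, in the direction `(x, y)`, the density (gain per cost) of `k` exceeds
that of `l`. -/
def adv (x y : ℤ) (k l : ℕ) : ℤ := D.c l * D.gain x y k - D.c k * D.gain x y l

/-- The item `k` does not come after `l` in the order of decreasing density, ties broken by the
index.  For indices below `n + 2` the sign of this one number decides the lexicographic
comparison. -/
def Before (x y : ℤ) (k l : ℕ) : Prop := 0 < D.adv x y k l * (D.n + 2) + l - k + 1

/-- Membership in the candidate described by the digits `t`.  The digits `0, …, 3` name the two
critical vectors whose sum is the direction, digit `4` the last item of the greedy prefix, digit `5`
the item that bounds the costs, and the digits from `6` on the items taken by force. -/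
def InCand (t : ℕ → ℕ) (k : ℕ) : Prop :=
  (∃ j < D.m, t (6 + j) = k) ∨ D.c k ≤ 0 ∨
    (D.c k ≤ D.c (t 5) ∧
      D.Before (D.dirX (t 0) (t 1) + D.dirX (t 2) (t 3))
        (D.dirY (t 0) (t 1) + D.dirY (t 2) (t 3)) k (t 4))

open Classical in
/-- The candidate described by the digits `t`. -/
noncomputable def candSet (t : ℕ → ℕ) : Finset ℕ := (Finset.range D.n).filter (D.InCand t)

variable {D}

theorem adv_eq_cross (x y : ℤ) (i j : ℕ) :
    D.adv x y i j = cross (x, y) (D.dirX i j, D.dirY i j) := by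
  simp only [adv, gain, cross, dirX, dirY]; ring

theorem exists_direction (hD : D.Proper) {x y : ℤ} (hu : InQuadrant (x, y))
    (hc : ∃ j < D.n, 0 < D.c j) :
    ∃ i₁ < D.n + 2, ∃ j₁ < D.n + 2, ∃ i₂ < D.n + 2, ∃ j₂ < D.n + 2, ∀ k < D.n, ∀ l < D.n,
      0 < D.adv x y k l →
        0 < D.adv (D.dirX i₁ j₁ + D.dirX i₂ j₂) (D.dirY i₁ j₁ + D.dirY i₂ j₂) k l := by
  obtain ⟨j, hj, hcj⟩ := hc
  let R := Finset.range (D.n + 2)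
  have hmem : ∀ {i j : ℕ}, i < D.n + 2 → j < D.n + 2 → (D.dirX i j, D.dirY i j) ∈
      (R ×ˢ R).image fun ij : ℕ × ℕ => (D.dirX ij.1 ij.2, D.dirY ij.1 ij.2) := fun {i j} hi hj =>
    Finset.mem_image.2 ⟨(i, j), by simp [R, hi, hj], rfl⟩
  obtain ⟨d, hd, e, he, h⟩ := exists_critical_sum
    ((R ×ˢ R).image fun ij : ℕ × ℕ => (D.dirX ij.1 ij.2, D.dirY ij.1 ij.2))
    (by
      intro g hg
      obtain ⟨⟨a, b⟩, hab, rfl⟩ := Finset.mem_image.1 hg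
      simp only [Finset.mem_product, R, Finset.mem_range] at hab
      convert hmem hab.2 hab.1 using 1
      simp [dirX, dirY])
    ⟨D.c j, hcj, by
      have := hmem (i := j) (j := D.n) (by omega) (by omega)
      simpa [dirX, dirY, hD.p_n, hD.q_n, hD.c_n] using this⟩
    ⟨D.c j, hcj, by
      have := hmem (i := D.n + 1) (j := j) (by omega) (by omega)
      simpa [dirX, dirY, hD.p_n1, hD.q_n1, hD.c_n1] using this⟩ hu
  obtain ⟨⟨i₁, j₁⟩, h₁, rfl⟩ := Finset.mem_image.1 hd
  obtain ⟨⟨i₂, j₂⟩, h₂, rfl⟩ := Finset.mem_image.1 he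
  simp only [Finset.mem_product, R, Finset.mem_range] at h₁ h₂
  refine ⟨i₁, h₁.1, j₁, h₁.2, i₂, h₂.1, j₂, h₂.2, fun k hk l hl hkl => ?_⟩
  rw [adv_eq_cross] at hkl ⊢
  exact h _ (hmem (by omega) (by omega)) hkl

/-- Key of the order of decreasing density. -/
def key (D : Scaled) (x y : ℤ) (k : ℕ) : ℚ ×ₗ ℤ :=
  toLex ((D.gain x y k : ℚ) / D.c k, -(k : ℤ))

theorem before_iff {x y : ℤ} {k l : ℕ} (hk : k < D.n) (hl : l < D.n) (hck : 0 < D.c k)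
    (hcl : 0 < D.c l) : D.Before x y k l ↔ D.key x y l ≤ D.key x y k := by
  have hck' : (0 : ℚ) < D.c k := by exact_mod_cast hck
  have hcl' : (0 : ℚ) < D.c l := by exact_mod_cast hcl
  rw [key, key, Prod.Lex.toLex_le_toLex, div_lt_div_iff₀ hcl' hck',
    div_eq_div_iff hcl'.ne' hck'.ne']
  have e1 : ((D.gain x y l : ℚ) * D.c k < D.gain x y k * D.c l) ↔ 0 < D.adv x y k l := by
    rw [adv, sub_pos, mul_comm (D.c l), mul_comm (D.c k)]; norm_cast
  have e2 : ((D.gain x y l : ℚ) * D.c k = D.gain x y k * D.c l) ↔ D.adv x y k l = 0 := by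
    rw [adv, sub_eq_zero, mul_comm (D.c l), mul_comm (D.c k), eq_comm]; norm_cast
  rw [e1, e2, Before]
  rcases lt_trichotomy (D.adv x y k l) 0 with h | h | h
  · constructor
    · intro h'; exfalso; nlinarith
    · rintro (h' | h') <;> omega
  · simp only [h]
    constructor
    · intro h'; right; exact ⟨trivial, by simp only [neg_le_neg_iff]; omega⟩
    · rintro (h' | ⟨-, h'⟩)
      · omega
      · simp only [neg_le_neg_iff] at h'; omega
  · simp only [h, true_or, iff_true]
    nlinarith

theorem key_injective (x y : ℤ) : Function.Injective (D.key x y) := by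
  intro k l h
  have := congrArg (fun z => (ofLex z).2) h
  simpa [key] using this

/-- A set `A` all of whose items are at least as dense as those of `B`, of smaller total gain, is
not more expensive. -/
theorem cost_le_of_dense {A B : Finset ℕ} {c g : ℕ → ℤ} (hc : ∀ k, 0 ≤ c k) (hg : ∀ k, 0 ≤ g k)
    (h : ∀ a ∈ A, ∀ b ∈ B, c a * g b ≤ c b * g a) (hlt : ∑ k ∈ A, g k < ∑ k ∈ B, g k) :
    ∑ k ∈ A, c k ≤ ∑ k ∈ B, c k := by
  have h1 : (∑ k ∈ A, c k) * ∑ k ∈ B, g k ≤ (∑ k ∈ B, c k) * ∑ k ∈ A, g k := by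
    rw [Finset.sum_mul_sum, Finset.sum_mul_sum, Finset.sum_comm]
    exact Finset.sum_le_sum fun b hb => Finset.sum_le_sum fun a ha => h a ha b hb
  have h2 : 0 ≤ ∑ k ∈ A, g k := Finset.sum_nonneg fun k _ => hg k
  have h3 : 0 ≤ ∑ k ∈ B, c k := Finset.sum_nonneg fun k _ => hc k
  by_contra! hlt'
  nlinarith [mul_pos (h3.trans_lt hlt') (sub_pos.2 hlt), mul_le_mul_of_nonneg_right hlt'.le h2]

theorem cost_le_of_dense_inter {A B : Finset ℕ} {c g : ℕ → ℤ} (hc : ∀ k, 0 ≤ c k)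
    (hg : ∀ k, 0 ≤ g k) (h : ∀ a ∈ A, ∀ b ∈ B, b ∉ A → c a * g b ≤ c b * g a)
    (hlt : ∑ k ∈ A, g k < ∑ k ∈ B, g k) : ∑ k ∈ A, c k ≤ ∑ k ∈ B, c k := by
  rw [← Finset.sum_sdiff (Finset.inter_subset_left : A ∩ B ⊆ A),
    ← Finset.sum_sdiff (Finset.inter_subset_right : A ∩ B ⊆ B)] at hlt ⊢
  have := cost_le_of_dense (A := A \ (A ∩ B)) (B := B \ (A ∩ B)) hc hg (by
    intro a ha b hb
    simp only [Finset.mem_sdiff, Finset.mem_inter, not_and] at ha hb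
    exact h a ha.1 b hb.1 fun hbA => hb.2 hbA hb.1) (by linarith)
  linarith

/-- The `m` most expensive elements of a set. -/
theorem exists_most_expensive (c : ℕ → ℤ) (O : Finset ℕ) (m : ℕ) (hm : m ≤ O.card) :
    ∃ S ⊆ O, S.card = m ∧ ∀ s ∈ S, ∀ k ∈ O, k ∉ S → c k ≤ c s := by
  classical
  induction m with
  | zero => exact ⟨∅, by simp, rfl, by simp⟩
  | succ m ih =>
    obtain ⟨S, hS, hcard, h⟩ := ih (by omega)
    obtain ⟨b, hb, hmax⟩ := Finset.exists_max_image (O \ S) c (by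
      rw [← Finset.card_pos, Finset.card_sdiff_of_subset hS]; omega)
    rw [Finset.mem_sdiff] at hb
    refine ⟨insert b S, Finset.insert_subset hb.1 hS, by
      rw [Finset.card_insert_of_notMem hb.2, hcard], fun s hs k hk hkS => ?_⟩
    rw [Finset.mem_insert, not_or] at hkS
    rcases Finset.mem_insert.1 hs with rfl | hs
    · exact hmax k (Finset.mem_sdiff.2 ⟨hk, hkS.2⟩)
    · exact h s hs k hk hkS.2

/-- The tuple of digits with given entries. -/
def mkDigits (i₁ j₁ i₂ j₂ l θ : ℕ) (L : List ℕ) : ℕ → ℕ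
  | 0 => i₁
  | 1 => j₁
  | 2 => i₂
  | 3 => j₂
  | 4 => l
  | 5 => θ
  | j + 6 => L.getD j θ

theorem mem_getD_iff {S : Finset ℕ} {m θ k : ℕ} (hθ : θ ∈ S) (hm : S.card ≤ m) :
    (∃ j < m, S.toList.getD j θ = k) ↔ k ∈ S := by
  constructor
  · rintro ⟨j, -, rfl⟩
    by_cases h : j < S.toList.length
    · rw [List.getD_eq_getElem _ _ h]
      exact Finset.mem_toList.1 (List.getElem_mem h)
    · rw [List.getD_eq_default _ _ (by omega)]
      exact hθ
  · intro hk
    obtain ⟨j, hj, rfl⟩ := List.getElem_of_mem (Finset.mem_toList.2 hk)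
    exact ⟨j, by rw [Finset.length_toList] at hj; omega, List.getD_eq_getElem _ _ hj⟩

theorem mkDigits_lt {N i₁ j₁ i₂ j₂ l θ : ℕ} {L : List ℕ} (h1 : i₁ < N) (h2 : j₁ < N) (h3 : i₂ < N)
    (h4 : j₂ < N) (h5 : l < N) (h6 : θ < N) (h7 : ∀ k ∈ L, k < N) (j : ℕ) :
    mkDigits i₁ j₁ i₂ j₂ l θ L j < N := by
  unfold mkDigits
  split <;> try assumption
  rename_i j
  by_cases h : j < L.length
  · rw [List.getD_eq_getElem _ _ h]
    exact h7 _ (List.getElem_mem h)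
  · rw [List.getD_eq_default _ _ (by omega)]
    exact h6

/-- Some candidate is good.  Let `u` be the vector of the set `O` (an optimal solution).  Taking the
`m` most expensive items of `O` by force and the rest greedily by their density in the direction `u`
gives a set whose vector reaches as far as `O` in the direction `u`, at an extra cost of one
item that is cheaper than each of the `m` forced ones. -/
theorem exists_candidate (hD : D.Proper) {O : Finset ℕ} (hO : O ⊆ Finset.range D.n) (hm : 1 ≤ D.m)
    {x y : ℤ} (hx : x = ∑ k ∈ O, D.p k) (hy : y = ∑ k ∈ O, D.q k) (hxy : 0 < x + y) :
    ∃ t : ℕ → ℕ, (∀ j, t j < D.n + 2) ∧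
      ∑ k ∈ O, D.gain x y k ≤ ∑ k ∈ D.candSet t, D.gain x y k ∧
      (∑ k ∈ D.candSet t, D.c k ≤ ∑ k ∈ O, D.c k ∨ (D.m < O.card ∧
        D.m * (∑ k ∈ D.candSet t, D.c k - ∑ k ∈ O, D.c k) ≤ ∑ k ∈ O, D.c k)) := by
  classical
  have hx0 : 0 ≤ x := hx ▸ Finset.sum_nonneg fun k _ => hD.p_nonneg k
  have hy0 : 0 ≤ y := hy ▸ Finset.sum_nonneg fun k _ => hD.q_nonneg k
  have hg0 : ∀ k, 0 ≤ D.gain x y k := fun k =>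
    add_nonneg (mul_nonneg hx0 (hD.p_nonneg k)) (mul_nonneg hy0 (hD.q_nonneg k))
  have hOne : O.Nonempty := by
    rw [Finset.nonempty_iff_ne_empty]
    rintro rfl
    simp at hx hy
    omega
  have hOn : ∀ k ∈ O, k < D.n := fun k hk => Finset.mem_range.1 (hO hk)
  obtain ⟨S, hSO, hScard, hStop⟩ := exists_most_expensive D.c O (min D.m O.card) (min_le_right _ _)
  have hSne : S.Nonempty := by
    rw [← Finset.card_pos, hScard]
    have := hOne.card_pos
    omega
  obtain ⟨θ, hθS, hθmin⟩ := Finset.exists_min_image S D.c hSne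
  have hSm : S.card ≤ D.m := by omega
  have hSn : ∀ k ∈ S.toList, k < D.n + 2 := fun k hk => by
    have := hOn k (hSO (Finset.mem_toList.1 hk)); omega
  have hθn : θ < D.n := hOn θ (hSO hθS)
  -- the items that are included in all candidates that force `S`
  let Z := (Finset.range D.n).filter fun k => k ∈ S ∨ D.c k ≤ 0
  have hcZ : ∑ k ∈ Z, D.c k ≤ ∑ k ∈ S, D.c k := by
    have hSZ : S ⊆ Z := fun k hk => by simp [Z, hk, hOn k (hSO hk)]
    rw [← Finset.sum_sdiff hSZ]
    have : ∑ k ∈ Z \ S, D.c k ≤ 0 := Finset.sum_nonpos fun k hk => by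
      simp only [Z, Finset.mem_sdiff, Finset.mem_filter] at hk
      tauto
    linarith
  have hcSO : ∑ k ∈ S, D.c k ≤ ∑ k ∈ O, D.c k :=
    Finset.sum_le_sum_of_subset_of_nonneg hSO fun k _ _ => hD.c_nonneg k
  by_cases hA : ∑ k ∈ O, D.gain x y k ≤ ∑ k ∈ Z, D.gain x y k
  · by_cases hc : ∃ j < D.n, 0 < D.c j
    · -- the direction is an axis and the greedy prefix ends with an auxiliary index: it is empty
      obtain ⟨j, hj, hcj⟩ := hc
      have hset : D.candSet (mkDigits (D.n + 1) j (D.n + 1) j D.n θ S.toList) = Z := by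
        simp only [candSet, Z]
        refine Finset.filter_congr fun k hk => ?_
        have hkn := Finset.mem_range.1 hk
        have h6 : ∀ i, mkDigits (D.n + 1) j (D.n + 1) j D.n θ S.toList (6 + i) =
            S.toList.getD i θ := fun i => by rw [add_comm 6]; rfl
        simp only [InCand, h6, mem_getD_iff hθS hSm]
        refine or_congr_right ?_
        rw [or_iff_left_iff_imp]
        rintro ⟨-, h⟩
        by_contra! hck
        simp only [mkDigits, Before, adv, gain, dirX, dirY, hD.p_n, hD.q_n, hD.c_n, hD.p_n1,
          hD.q_n1, hD.c_n1] at h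
        have := mul_pos hck hcj
        nlinarith
      refine ⟨mkDigits (D.n + 1) j (D.n + 1) j D.n θ S.toList,
        mkDigits_lt (by omega) (by omega) (by omega) (by omega) (by omega) (by omega) hSn, ?_, ?_⟩
      · rw [hset]; exact hA
      · left; rw [hset]; linarith
    · -- all items are free, and every candidate consists of all of them
      push Not at hc
      have hset : ∀ t, D.candSet t = Finset.range D.n := fun t => by
        simp only [candSet]
        refine Finset.filter_true_of_mem fun k hk => Or.inr (Or.inl (hc k (Finset.mem_range.1 hk)))
      refine ⟨fun _ => 0, fun _ => by positivity, ?_, ?_⟩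
      · rw [hset]
        exact Finset.sum_le_sum_of_subset_of_nonneg hO fun k _ _ => hg0 k
      · left
        rw [hset]
        exact (Finset.sum_nonpos fun k hk => hc k (Finset.mem_range.1 hk)).trans
          (Finset.sum_nonneg fun k _ => hD.c_nonneg k)
  · push Not at hA
    -- the items that remain for the greedy prefix
    let R := (Finset.range D.n).filter fun k => k ∉ S ∧ 0 < D.c k ∧ D.c k ≤ D.c θ
    have hR : ∀ {k}, k ∈ R ↔ k < D.n ∧ k ∉ S ∧ 0 < D.c k ∧ D.c k ≤ D.c θ := by simp [R]
    have hOsub : O ⊆ Z ∪ R := fun k hk => by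
      have hkn := hOn k hk
      by_cases hkS : k ∈ S
      · simp [Z, hkS, hkn]
      · have := hStop θ hθS k hk hkS
        by_cases hck : D.c k ≤ 0
        · simp [Z, hck, hkn]
        · refine Finset.mem_union_right _ (hR.2 ⟨hkn, hkS, by omega, this⟩)
    have hZR : Disjoint Z R := by
      rw [Finset.disjoint_left]
      intro k hk hk'
      simp only [Z, Finset.mem_filter] at hk
      have := hR.1 hk'
      rcases hk.2 with h | h
      · exact this.2.1 h
      · omega
    have hRne : R.Nonempty := by
      rw [Finset.nonempty_iff_ne_empty]
      intro h
      rw [h, Finset.union_empty] at hOsub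
      exact absurd (Finset.sum_le_sum_of_subset_of_nonneg hOsub fun k _ _ => hg0 k) (not_le.2 hA)
    obtain ⟨j, hjR⟩ := id hRne
    obtain ⟨i₁, hi₁, j₁, hj₁, i₂, hi₂, j₂, hj₂, hdir⟩ := exists_direction hD
      (x := x) (y := y) ⟨hx0, hy0, hxy⟩ ⟨j, (hR.1 hjR).1, (hR.1 hjR).2.2.1⟩
    set X := D.dirX i₁ j₁ + D.dirX i₂ j₂
    set Y := D.dirY i₁ j₁ + D.dirY i₂ j₂
    let T : ℕ → Finset ℕ := fun l => R.filter fun k => D.key X Y l ≤ D.key X Y k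
    let good : Finset ℕ := R.filter fun l =>
      ∑ k ∈ O, D.gain x y k ≤ ∑ k ∈ Z, D.gain x y k + ∑ k ∈ T l, D.gain x y k
    have hgood : good.Nonempty := by
      obtain ⟨l, hl, hmin⟩ := Finset.exists_min_image R (D.key X Y) hRne
      refine ⟨l, Finset.mem_filter.2 ⟨hl, ?_⟩⟩
      have : T l = R := Finset.filter_true_of_mem hmin
      rw [this, ← Finset.sum_union hZR]
      exact Finset.sum_le_sum_of_subset_of_nonneg hOsub fun k _ _ => hg0 k
    obtain ⟨l, hl, hlmax⟩ := Finset.exists_max_image good (D.key X Y) hgood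
    obtain ⟨hlR, hlgood⟩ := Finset.mem_filter.1 hl
    have hlT : l ∈ T l := Finset.mem_filter.2 ⟨hlR, le_rfl⟩
    have hset : D.candSet (mkDigits i₁ j₁ i₂ j₂ l θ S.toList) = Z ∪ T l := by
      ext k
      simp only [candSet, Z, T, Finset.mem_union, Finset.mem_filter, hR, Finset.mem_range]
      have h6 : ∀ i, mkDigits i₁ j₁ i₂ j₂ l θ S.toList (6 + i) =
          S.toList.getD i θ := fun i => by rw [add_comm 6]; rfl
      simp only [InCand, h6, mem_getD_iff hθS hSm]
      by_cases hkn : k < D.n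
      · by_cases hkS : k ∈ S
        · simp [hkn, hkS]
        · by_cases hck : D.c k ≤ 0
          · simp [hkn, hck]
          · have := before_iff (x := X) (y := Y) hkn (hR.1 hlR).1 (not_le.1 hck) (hR.1 hlR).2.2.1
            simp only [hkn, hkS, hck, not_le.1 hck, true_and, false_or, mkDigits, not_false_eq_true]
            exact and_congr_right fun _ => this
      · simp [hkn]
    have hdisj : Disjoint Z (T l) := hZR.mono_right (Finset.filter_subset _ _)
    refine ⟨mkDigits i₁ j₁ i₂ j₂ l θ S.toList, mkDigits_lt hi₁ hj₁ hi₂ hj₂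
      (by have := (hR.1 hlR).1; omega) (by omega) hSn, ?_, ?_⟩
    · rw [hset, Finset.sum_union hdisj]; exact hlgood
    -- without its last item the greedy prefix falls short of `O`
    have hshort : ∑ k ∈ Z, D.gain x y k + ∑ k ∈ (T l).erase l, D.gain x y k <
        ∑ k ∈ O, D.gain x y k := by
      rcases ((T l).erase l).eq_empty_or_nonempty with h | h
      · rw [h]; simpa using hA
      · obtain ⟨l', hl', hmin⟩ := Finset.exists_min_image _ (D.key X Y) h
        rw [Finset.mem_erase, Finset.mem_filter] at hl'
        have hlt : D.key X Y l < D.key X Y l' :=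
          lt_of_le_of_ne hl'.2.2 fun h => hl'.1 (key_injective X Y h).symm
        have hT : (T l).erase l = T l' := by
          ext k
          constructor
          · intro hk
            have h1 := hmin k hk
            simp only [T, Finset.mem_erase, Finset.mem_filter] at hk ⊢
            exact ⟨hk.2.1, h1⟩
          · intro hk
            simp only [T, Finset.mem_erase, Finset.mem_filter] at hk ⊢
            refine ⟨?_, hk.1, hlt.le.trans hk.2⟩
            rintro rfl
            exact absurd hk.2 (not_le.2 hlt)
        rw [hT]
        by_contra! hcon
        exact absurd (hlmax l' (Finset.mem_filter.2 ⟨hl'.2.1, hcon⟩)) (not_le.2 hlt)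
    have hsplit : ∀ f : ℕ → ℤ, ∑ k ∈ O ∩ Z, f k + ∑ k ∈ O ∩ R, f k = ∑ k ∈ O, f k := fun f => by
      rw [← Finset.sum_union (hZR.mono Finset.inter_subset_right Finset.inter_subset_right),
        ← Finset.inter_union_distrib_left, Finset.inter_eq_left.2 hOsub]
    have hcT : ∑ k ∈ (T l).erase l, D.c k ≤ ∑ k ∈ O ∩ R, D.c k := by
      refine cost_le_of_dense_inter (g := D.gain x y) hD.c_nonneg hg0 ?_ ?_
      · intro a ha b hb hbA
        simp only [T, Finset.mem_erase, Finset.mem_filter, Finset.mem_inter] at ha hb hbA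
        have hba : D.key X Y b ≤ D.key X Y a := by
          by_cases hbl : b = l
          · rw [hbl]; exact ha.2.2
          · have : ¬ D.key X Y l ≤ D.key X Y b := fun h => hbA ⟨hbl, hb.2, h⟩
            exact (not_le.1 this).le.trans ha.2.2
        have han := hR.1 ha.2.1
        have hbn := hR.1 hb.2
        by_contra! hcon
        have h1 := hdir b hbn.1 a han.1 (by rw [adv]; linarith)
        have h2 := (before_iff (x := X) (y := Y) han.1 hbn.1 han.2.2.1 hbn.2.2.1).2 hba
        have h3 : D.adv X Y a b = - D.adv X Y b a := by simp only [adv]; ring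
        rw [Before, h3] at h2
        have := han.1
        have := hbn.1
        nlinarith
      · have h1 := hsplit (D.gain x y)
        have h2 : ∑ k ∈ O ∩ Z, D.gain x y k ≤ ∑ k ∈ Z, D.gain x y k :=
          Finset.sum_le_sum_of_subset_of_nonneg Finset.inter_subset_right fun k _ _ => hg0 k
        linarith
    have hmO : D.m < O.card := by
      by_contra! hcon
      have hSeq : S = O := Finset.eq_of_subset_of_card_le hSO (by omega)
      refine absurd (Finset.sum_le_sum_of_subset_of_nonneg (?_ : O ⊆ Z) fun k _ _ => hg0 k)
        (not_le.2 hA)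
      intro k hk
      simp [Z, hSeq, hk, hOn k hk]
    right
    refine ⟨hmO, ?_⟩
    have hlsum := Finset.add_sum_erase (T l) D.c hlT
    have hcZO : ∑ k ∈ Z, D.c k ≤ ∑ k ∈ O ∩ Z, D.c k := by
      refine hcZ.trans (Finset.sum_le_sum_of_subset_of_nonneg ?_ fun k _ _ => hD.c_nonneg k)
      intro k hk
      simp [Z, hk, hSO hk, hOn k (hSO hk)]
    have h1 := hsplit D.c
    have h2 := (hR.1 hlR).2.2.2
    have h3 : (D.m : ℤ) * D.c θ ≤ ∑ k ∈ O, D.c k := by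
      refine le_trans ?_ hcSO
      have := Finset.card_nsmul_le_sum S D.c (D.c θ) hθmin
      rw [hScard, min_eq_left hmO.le] at this
      simpa using this
    rw [hset, Finset.sum_union hdisj]
    have h4 : (0 : ℤ) ≤ D.m := by positivity
    have h5 : ∑ k ∈ Z, D.c k + ∑ k ∈ T l, D.c k - ∑ k ∈ O, D.c k ≤ D.c θ := by linarith
    nlinarith

end Scaled

end MinCKP

/-! ### Cost of expressions -/

namespace RAM

/-- A bound, up to the word length of the memory, for the length of the value of an expression. -/
def Expr.weight : Expr → ℕ
  | .const k => k.natAbs + 1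
  | .cell _ => 1
  | .add e₁ e₂ => e₁.weight + e₂.weight
  | .sub e₁ e₂ => e₁.weight + e₂.weight
  | .mul e₁ e₂ => e₁.weight + e₂.weight

/-- A bound, up to the word length of the memory, for the cost of an expression. -/
def Expr.charge : Expr → ℕ
  | .const k => k.natAbs + 1
  | .cell e => e.charge + 1
  | .add e₁ e₂ => e₁.charge + e₂.charge + (e₁.weight + e₂.weight)
  | .sub e₁ e₂ => e₁.charge + e₂.charge + (e₁.weight + e₂.weight)
  | .mul e₁ e₂ => e₁.charge + e₂.charge + (e₁.weight + e₂.weight)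

/-- All cells hold numbers of absolute value at most `M`. -/
def Bounded (M : ℕ) (s : Mem) : Prop := ∀ z, |s z| ≤ M

/-- Word length of a memory all of whose cells are bounded by `M`. -/
def width (M : ℕ) : ℕ := Nat.size M + 1

theorem bits_le_of_lt {z : ℤ} {w : ℕ} (h : z.natAbs < 2 ^ w) : bits z ≤ w + 1 :=
  Nat.succ_le_succ (Nat.size_le.2 h)

theorem natAbs_lt_two_pow (z : ℤ) : z.natAbs < 2 ^ (bits z - 1) := Nat.size_le.1 (by simp [bits])

theorem one_le_bits (z : ℤ) : 1 ≤ bits z := Nat.succ_pos _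

theorem bits_const_le (k : ℤ) : bits k ≤ k.natAbs + 1 := bits_le_of_lt Nat.lt_two_pow_self

theorem natAbs_add_lt {a b : ℤ} {x y : ℕ} (ha : a.natAbs < 2 ^ x) (hb : b.natAbs < 2 ^ y) :
    a.natAbs + b.natAbs < 2 ^ (x + y + 1) := by
  have h1 : 2 ^ x ≤ 2 ^ (x + y) := Nat.pow_le_pow_right (by norm_num) (by omega)
  have h2 : 2 ^ y ≤ 2 ^ (x + y) := Nat.pow_le_pow_right (by norm_num) (by omega)
  rw [pow_succ]
  omega

theorem bits_add_le (a b : ℤ) : bits (a + b) ≤ bits a + bits b := by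
  have h := natAbs_add_lt (natAbs_lt_two_pow a) (natAbs_lt_two_pow b)
  have h1 := bits_le_of_lt ((Int.natAbs_add_le a b).trans_lt h)
  have := one_le_bits a
  have := one_le_bits b
  omega

theorem bits_neg (a : ℤ) : bits (-a) = bits a := by simp [bits]

theorem bits_sub_le (a b : ℤ) : bits (a - b) ≤ bits a + bits b := by
  rw [sub_eq_add_neg, ← bits_neg b]; exact bits_add_le _ _

theorem bits_mul_le (a b : ℤ) : bits (a * b) ≤ bits a + bits b := by
  have h : (a * b).natAbs < 2 ^ (bits a - 1 + (bits b - 1)) := by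
    rw [Int.natAbs_mul, pow_add]
    exact Nat.mul_lt_mul'' (natAbs_lt_two_pow a) (natAbs_lt_two_pow b)
  have h1 := bits_le_of_lt h
  have := one_le_bits a
  have := one_le_bits b
  omega

theorem Bounded.bits_le {M : ℕ} {s : Mem} (hs : Bounded M s) (z : ℤ) : bits (s z) ≤ width M := by
  refine Nat.succ_le_succ (Nat.size_le_size ?_)
  have := hs z
  rw [Int.abs_eq_natAbs] at this
  exact_mod_cast this

theorem one_le_width (M : ℕ) : 1 ≤ width M := Nat.succ_pos _

theorem Expr.bits_eval_le {M : ℕ} {s : Mem} (hs : Bounded M s) :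
    ∀ e : Expr, bits (e.eval s) ≤ e.weight * width M
  | .const k => (bits_const_le k).trans (Nat.le_mul_of_pos_right _ (one_le_width M))
  | .cell e => by simpa [eval, weight] using hs.bits_le _
  | .add e₁ e₂ => by
    rw [eval, weight, add_mul]
    exact (bits_add_le _ _).trans (add_le_add (bits_eval_le hs e₁) (bits_eval_le hs e₂))
  | .sub e₁ e₂ => by
    rw [eval, weight, add_mul]
    exact (bits_sub_le _ _).trans (add_le_add (bits_eval_le hs e₁) (bits_eval_le hs e₂))
  | .mul e₁ e₂ => by
    rw [eval, weight, add_mul]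
    exact (bits_mul_le _ _).trans (add_le_add (bits_eval_le hs e₁) (bits_eval_le hs e₂))

theorem Expr.cost_le {M : ℕ} {s : Mem} (hs : Bounded M s) :
    ∀ e : Expr, e.cost s ≤ e.charge * width M
  | .const k => (bits_const_le k).trans (Nat.le_mul_of_pos_right _ (one_le_width M))
  | .cell e => by
    rw [cost, charge, add_mul, one_mul]
    exact add_le_add (cost_le hs e) (hs.bits_le _)
  | .add e₁ e₂ => by
    rw [cost, charge, add_mul, add_mul]
    exact add_le_add (add_le_add (cost_le hs e₁) (cost_le hs e₂)) ((Expr.add e₁ e₂).bits_eval_le hs)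
  | .sub e₁ e₂ => by
    rw [cost, charge, add_mul, add_mul]
    exact add_le_add (add_le_add (cost_le hs e₁) (cost_le hs e₂)) ((Expr.sub e₁ e₂).bits_eval_le hs)
  | .mul e₁ e₂ => by
    rw [cost, charge, add_mul, add_mul]
    exact add_le_add (add_le_add (cost_le hs e₁) (cost_le hs e₂)) ((Expr.mul e₁ e₂).bits_eval_le hs)

/-! ### Total correctness with a time bound -/

/-- Bound for the cost of one elementary step, in words.  The value has no meaning of its own: it is
large enough for all assignments and tests of the program. -/
def unit : ℕ := 2000

/-- Started in `s`, the program `c` halts after at most `T` elementary steps in a memory that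
satisfies `Q`, and the cells stay bounded by `M`.  One elementary step is an assignment or a test;
it costs at most `unit` words of length `width M`. -/
def Runs (M : ℕ) (c : Prog) (s : Mem) (T : ℕ) (Q : Mem → Prop) : Prop :=
  Bounded M s → ∃ t s', Exec c s t s' ∧ t ≤ T * (unit * width M) ∧ Bounded M s' ∧ Q s'

variable {M : ℕ} {c c₁ c₂ : Prog} {s : Mem} {T T₁ T₂ : ℕ} {Q : Mem → Prop} {e : Expr}

theorem one_add_cost_le (hs : Bounded M s) (hc : 1 + e.charge ≤ unit) :
    1 + e.cost s ≤ unit * width M := by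
  calc 1 + e.cost s ≤ width M + e.charge * width M :=
        add_le_add (one_le_width M) (e.cost_le hs)
    _ = (1 + e.charge) * width M := by ring
    _ ≤ _ := Nat.mul_le_mul_right _ hc

theorem Runs.mono {Q' : Mem → Prop} (h : Runs M c s T₁ Q') (hT : T₁ ≤ T) (hQ : ∀ s', Q' s' → Q s') :
    Runs M c s T Q := by
  intro hs
  obtain ⟨t, s', h1, h2, h3, h4⟩ := h hs
  exact ⟨t, s', h1, h2.trans (Nat.mul_le_mul_right _ hT), h3, hQ _ h4⟩

theorem Runs.skip (h : Q s) : Runs M .skip s 1 Q := fun hs =>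
  ⟨1, s, .skip s, by
    rw [one_mul]; exact Nat.mul_pos (by norm_num [unit]) (one_le_width M), hs, h⟩

theorem Runs.store {a : Expr} {k v : ℤ} (hc : 1 + (a.charge + e.charge) ≤ unit) (hk : a.eval s = k)
    (hv : e.eval s = v) (hb : |v| ≤ M) (h : Q (Function.update s k v)) :
    Runs M (.store a e) s 1 Q := by
  subst hk hv
  intro hs
  refine ⟨_, _, .store a e s, ?_, ?_, h⟩
  · rw [one_mul]
    calc 1 + a.cost s + e.cost s ≤ width M + a.charge * width M + e.charge * width M :=
          add_le_add (add_le_add (one_le_width M) (a.cost_le hs)) (e.cost_le hs)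
      _ = (1 + (a.charge + e.charge)) * width M := by ring
      _ ≤ _ := Nat.mul_le_mul_right _ hc
  · intro z
    rw [Function.update_apply]
    split_ifs
    · exact hb
    · exact hs z

theorem Runs.seq (h : Runs M c₁ s T₁ fun s₁ => Runs M c₂ s₁ T₂ Q) :
    Runs M (.seq c₁ c₂) s (T₁ + T₂) Q := by
  intro hs
  obtain ⟨t₁, s₁, h1, h2, h3, h4⟩ := h hs
  obtain ⟨t₂, s₂, h5, h6, h7, h8⟩ := h4 h3
  exact ⟨_, s₂, .seq h1 h5, by rw [add_mul]; exact add_le_add h2 h6, h7, h8⟩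

theorem Runs.ite (hc : 1 + e.charge ≤ unit) (hp : 0 < e.eval s → Runs M c₁ s T Q)
    (hn : ¬ 0 < e.eval s → Runs M c₂ s T Q) : Runs M (.ite e c₁ c₂) s (T + 1) Q := by
  intro hs
  have hcost := one_add_cost_le hs hc
  by_cases he : 0 < e.eval s
  · obtain ⟨t, s', h1, h2, h3⟩ := hp he hs
    exact ⟨_, s', .ite_pos he h1, by rw [add_mul, one_mul]; omega, h3⟩
  · obtain ⟨t, s', h1, h2, h3⟩ := hn he hs
    exact ⟨_, s', .ite_neg he h1, by rw [add_mul, one_mul]; omega, h3⟩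

/-- Rule for a loop that makes at most `N` rounds. -/
theorem Runs.loop (I : ℕ → Mem → Prop) (N : ℕ) (hc : 1 + e.charge ≤ unit)
    (hstep : ∀ i s, i ≤ N → I i s → (¬ 0 < e.eval s ∧ Q s) ∨
      (i < N ∧ 0 < e.eval s ∧ Runs M c s T (I (i + 1)))) (h0 : I 0 s) :
    Runs M (.loop e c) s (N * (T + 1) + 1) Q := by
  have key : ∀ j i s, i + j = N → I i s → Runs M (.loop e c) s (j * (T + 1) + 1) Q := by
    intro j
    induction j with
    | zero =>
      intro i s hi hI hs
      rcases hstep i s (by omega) hI with ⟨he, hQ⟩ | ⟨hlt, -⟩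
      · exact ⟨_, s, .loop_done he, by simpa using one_add_cost_le hs hc, hs, hQ⟩
      · omega
    | succ j ih =>
      intro i s hi hI hs
      have hcost := one_add_cost_le hs hc
      rcases hstep i s (by omega) hI with ⟨he, hQ⟩ | ⟨-, he, hr⟩
      · refine ⟨_, s, .loop_done he, hcost.trans ?_, hs, hQ⟩
        exact Nat.le_mul_of_pos_left _ (by omega)
      · obtain ⟨t₁, s₁, h1, h2, h3, h4⟩ := hr hs
        obtain ⟨t₂, s₂, h5, h6, h7, h8⟩ := ih (i + 1) s₁ (by omega) h4 h3
        refine ⟨_, s₂, .loop_step he h1 h5, ?_, h7, h8⟩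
        have : ((j + 1) * (T + 1) + 1) * (unit * width M) = unit * width M +
            T * (unit * width M) + (j * (T + 1) + 1) * (unit * width M) := by ring
        omega
  exact key N 0 s (by omega) h0

/-! ### Arrays -/

/-- Entry `k` of the array `a`.  There are eight arrays, interleaved on the negative addresses. -/
def mget (s : Mem) (a k : ℤ) : ℤ := s (-1 - a - 8 * k)

/-- Overwrite the entry `k` of the array `a`. -/
def mset (s : Mem) (a k v : ℤ) : Mem := Function.update s (-1 - a - 8 * k) v

/-- Address of an array entry. -/
def adr (a : ℤ) (i : Expr) : Expr := .sub (.const (-1 - a)) (.mul (.const 8) i)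

/-- Read an array entry. -/
def rd (a : ℤ) (i : Expr) : Expr := .cell (adr a i)

/-- Write an array entry. -/
def wr (a : ℤ) (i e : Expr) : Prog := .store (adr a i) e

/-- The variable number `v`, an entry of the array `0`. -/
def var (v : ℤ) : Expr := rd 0 (.const v)

/-- Assignment to a variable. -/
def setVar (v : ℤ) (e : Expr) : Prog := wr 0 (.const v) e

@[simp] theorem eval_const (k : ℤ) : (Expr.const k).eval s = k := rfl
@[simp] theorem eval_add (e₁ e₂ : Expr) : (Expr.add e₁ e₂).eval s = e₁.eval s + e₂.eval s := rfl
@[simp] theorem eval_sub (e₁ e₂ : Expr) : (Expr.sub e₁ e₂).eval s = e₁.eval s - e₂.eval s := rfl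
@[simp] theorem eval_mul (e₁ e₂ : Expr) : (Expr.mul e₁ e₂).eval s = e₁.eval s * e₂.eval s := rfl
@[simp] theorem eval_cell (e : Expr) : (Expr.cell e).eval s = s (e.eval s) := rfl
@[simp] theorem eval_rd (a : ℤ) (i : Expr) : (rd a i).eval s = mget s a (i.eval s) := rfl
@[simp] theorem eval_var (v : ℤ) : (var v).eval s = mget s 0 v := rfl

@[simp] theorem mget_mset (s : Mem) (a k k' v : ℤ) :
    mget (mset s a k v) a k' = if k' = k then v else mget s a k' := by
  simp only [mget, mset, Function.update_apply]
  congr 1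
  simp only [eq_iff_iff]
  omega

@[simp] theorem mget_mset_ne {a a' : ℤ} (s : Mem) (k k' v : ℤ) (ha : 0 ≤ a) (ha' : 0 ≤ a')
    (hb : a < 8) (hb' : a' < 8) (h : a' ≠ a) : mget (mset s a k v) a' k' = mget s a' k' := by
  simp only [mget, mset, Function.update_apply]
  rw [if_neg (by omega)]

theorem mset_apply_of_nonneg {a k z : ℤ} (s : Mem) (v : ℤ) (ha : 0 ≤ a) (hk : 0 ≤ k) (hz : 0 ≤ z) :
    mset s a k v z = s z := by
  simp only [mset, Function.update_apply]
  rw [if_neg (by omega)]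

theorem mget_update_of_nonneg {a k z : ℤ} (s : Mem) (v : ℤ) (ha : 0 ≤ a) (hk : 0 ≤ k) (hz : 0 ≤ z) :
    mget (Function.update s z v) a k = mget s a k := by
  simp only [mget, Function.update_apply]
  rw [if_neg (by omega)]

theorem Runs.wr {a k v : ℤ} {i : Expr} (hc : 1 + ((adr a i).charge + e.charge) ≤ unit)
    (hk : i.eval s = k) (hv : e.eval s = v) (hb : |v| ≤ M) (h : Q (mset s a k v)) :
    Runs M (wr a i e) s 1 Q :=
  Runs.store hc (by simp [adr, hk]) hv hb h

theorem Runs.wr_seq {a : ℤ} {i : Expr} (k v : ℤ) (hc : 1 + ((adr a i).charge + e.charge) ≤ unit)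
    (hk : i.eval s = k) (hv : e.eval s = v) (hb : |v| ≤ M) (h : Runs M c (mset s a k v) T Q) :
    Runs M (.seq (RAM.wr a i e) c) s (T + 1) Q := by
  rw [add_comm]
  exact Runs.seq (Runs.wr hc hk hv hb h)

theorem Runs.setVar_seq {x : ℤ} (v : ℤ)
    (hc : 1 + ((adr 0 (.const x)).charge + e.charge) ≤ unit)
    (hv : e.eval s = v) (hb : |v| ≤ M) (h : Runs M c (mset s 0 x v) T Q) :
    Runs M (.seq (setVar x e) c) s (T + 1) Q :=
  Runs.wr_seq x v hc rfl hv hb h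

theorem Runs.setVar {x : ℤ} (v : ℤ) (hc : 1 + ((adr 0 (.const x)).charge + e.charge) ≤ unit)
    (hv : e.eval s = v) (hb : |v| ≤ M) (h : Q (mset s 0 x v)) : Runs M (setVar x e) s 1 Q :=
  Runs.wr hc rfl hv hb h

/-- Let the variable `v` run through the numbers below the value of `b`. -/
def forTo (v : ℤ) (b : Expr) (c : Prog) : Prog :=
  .seq (setVar v (.const 0)) (.loop (.sub b (var v))
    (.seq c (setVar v (.add (var v) (.const 1)))))

/-- Rule for `forTo`, for an invariant that does not mention the loop variable. -/
theorem Runs.forTo {v : ℤ} {b : Expr} (I : ℕ → Mem → Prop) (N : ℕ)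
    (hv : 1 + ((adr 0 (.const v)).charge + (Expr.add (var v) (.const 1)).charge) ≤ unit)
    (hc : 1 + (Expr.sub b (var v)).charge ≤ unit) (hN : N ≤ M)
    (hb : ∀ i s, I i s → b.eval s = N) (hI : ∀ i s x, I i s → I i (mset s 0 v x)) (h0 : I 0 s)
    (hbody : ∀ i < N, ∀ s, mget s 0 v = i → I i s →
      Runs M c s T fun s' => mget s' 0 v = i ∧ I (i + 1) s')
    (hQ : ∀ s, I N s → Q s) : Runs M (forTo v b c) s (N * (T + 2) + 2) Q := by
  have hv' : 1 + ((adr 0 (.const v)).charge + (Expr.const 0).charge) ≤ unit :=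
    le_trans (by simp only [Expr.charge, Expr.weight, var, rd]; omega) hv
  have hloop : Runs M (.loop (.sub b (var v)) (.seq c (RAM.setVar v (.add (var v) (.const 1)))))
      (mset s 0 v 0) (N * (T + 1 + 1) + 1) Q := by
    refine Runs.loop (fun i s => mget s 0 v = i ∧ I i s) N hc ?_ ⟨by simp, hI _ _ _ h0⟩
    rintro i s hi ⟨hiv, hIi⟩
    have he : (Expr.sub b (var v)).eval s = N - i := by simp [hb i s hIi, hiv]
    rw [he]
    rcases hi.eq_or_lt with rfl | hlt
    · left; exact ⟨by simp, hQ _ hIi⟩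
    · right
      refine ⟨hlt, by omega, Runs.seq ((hbody i hlt s hiv hIi).mono le_rfl ?_)⟩
      rintro s' ⟨h1, h2⟩
      refine Runs.setVar (i + 1 : ℤ) hv (by simp [h1]) ?_ ⟨by simp, hI _ _ _ h2⟩
      rw [abs_of_nonneg (by omega)]; omega
  refine (Runs.setVar_seq 0 hv' rfl (by simp) hloop).mono (by
    have : N * (T + 1 + 1) = N * (T + 2) := rfl
    omega) fun _ h => h

end RAM

/-! ### The search through all candidates -/

open RAM

namespace MinCKP

/-- Indicator of a proposition. -/
noncomputable def ind (P : Prop) : ℤ := open Classical in if P then 1 else 0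

theorem ind_of_true {P : Prop} (h : P) : ind P = 1 := if_pos h

theorem ind_of_false {P : Prop} (h : ¬ P) : ind P = 0 := if_neg h

theorem ind_nonneg (P : Prop) : 0 ≤ ind P := by unfold ind; split_ifs <;> simp

theorem ind_le_one (P : Prop) : ind P ≤ 1 := by unfold ind; split_ifs <;> simp

theorem abs_ind_le (P : Prop) : |ind P| ≤ 1 := by
  rw [abs_of_nonneg (ind_nonneg P)]; exact ind_le_one P

namespace Scaled

/-- The set `X` satisfies the constraint. -/
def Feas (D : Scaled) (X : Finset ℕ) : Prop :=
  D.thr ≤ D.den * ((∑ k ∈ X, D.p k) ^ 2 + (∑ k ∈ X, D.q k) ^ 2)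

/-- `b` is the cost, and `β` the indicator vector, of a feasible set that is at least as cheap as
all feasible sets of the family `F`; `b = -1` says that no feasible set has been found. -/
structure Best (D : Scaled) (F : Set (Finset ℕ)) (β : ℕ → ℤ) (b : ℤ) : Prop where
  attained : b = -1 ∨ ∃ X ⊆ Finset.range D.n, D.Feas X ∧ b = ∑ k ∈ X, D.c k ∧
    ∀ k < D.n, β k = ind (k ∈ X)
  le : ∀ X ∈ F, D.Feas X → 0 ≤ b ∧ b ≤ ∑ k ∈ X, D.c k

/-- The data fit into cells that are bounded by `M`, with room for the intermediate results. -/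
structure Fits (D : Scaled) (G : ℤ) (M : ℕ) : Prop where
  p_le : ∀ k, D.p k ≤ G
  q_le : ∀ k, D.q k ≤ G
  c_le : ∀ k, D.c k ≤ G
  sq_le : 4 * G ^ 2 ≤ M
  mul_le : D.n * G ≤ M
  le : D.n + D.m + 8 ≤ M

/-- The memory holds the scaled instance: its numbers in the array `5`, its vectors, interleaved, in
the array `1`. -/
structure Env (D : Scaled) (s : Mem) : Prop where
  n : mget s 5 0 = D.n
  m : mget s 5 1 = D.m
  thr : mget s 5 2 = D.thr
  den : mget s 5 3 = D.den
  p : ∀ k : ℕ, mget s 1 (3 * k) = D.p k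
  q : ∀ k : ℕ, mget s 1 (3 * k + 1) = D.q k
  c : ∀ k : ℕ, mget s 1 (3 * k + 2) = D.c k

/-- In addition to the scaled instance, the memory holds the best set found so far in the array
`4` and its cost in the variable `6`. -/
structure Ctx (D : Scaled) (β : ℕ → ℤ) (b : ℤ) (s : Mem) : Prop extends D.Env s where
  best : ∀ k : ℕ, mget s 4 k = β k
  cost : mget s 0 6 = b

/-- The memory holds the first `m + 6` digits of `t` in the array `2`. -/
def Digits (D : Scaled) (t : ℕ → ℕ) (s : Mem) : Prop := ∀ j < D.m + 6, mget s 2 j = t j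

variable {D : Scaled} {β : ℕ → ℤ} {b G : ℤ} {s : Mem} {t : ℕ → ℕ} {M : ℕ}

theorem Env.mset {a : ℤ} (h : D.Env s) (k v : ℤ) (ha : 0 ≤ a ∧ a < 8 ∧ a ≠ 1 ∧ a ≠ 5) :
    D.Env (mset s a k v) := by
  obtain ⟨h1, h2, h3, h4⟩ := ha
  constructor
  all_goals
    intros
    rw [mget_mset_ne _ _ _ _ h1 (by norm_num) h2 (by norm_num) (by omega)]
    apply_rules [h.n, h.m, h.thr, h.den, h.p, h.q, h.c]

theorem Ctx.mset {a k : ℤ} (h : D.Ctx β b s) (v : ℤ) (ha : a = 3 ∨ a = 2 ∨ (a = 0 ∧ k ≠ 6)) :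
    D.Ctx β b (mset s a k v) := by
  refine ⟨h.toEnv.mset k v (by omega), fun i => ?_, ?_⟩
  · rw [mget_mset_ne _ _ _ _ (by omega) (by norm_num) (by omega) (by norm_num) (by omega)]
    exact h.best i
  · rcases ha with rfl | rfl | ⟨rfl, hk⟩
    · simpa using h.cost
    · simpa using h.cost
    · simpa [hk.symm] using h.cost

theorem Digits.mset {a : ℤ} (h : D.Digits t s) (k v : ℤ) (ha : 0 ≤ a ∧ a < 8 ∧ a ≠ 2) :
    D.Digits t (mset s a k v) := fun j hj => by
  rw [mget_mset_ne _ _ _ _ ha.1 (by norm_num) ha.2.1 (by norm_num) (by omega)]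
  exact h j hj

theorem candSet_congr {t t' : ℕ → ℕ} (h : ∀ j < D.m + 6, t j = t' j) :
    D.candSet t = D.candSet t' := by
  unfold candSet
  congr 1
  ext k
  have h6 : (∃ j < D.m, t (6 + j) = k) ↔ ∃ j < D.m, t' (6 + j) = k :=
    exists_congr fun j => and_congr_right fun hj => by rw [h _ (by omega)]
  rw [InCand, InCand, h6, h 0 (by omega), h 1 (by omega), h 2 (by omega), h 3 (by omega),
    h 4 (by omega), h 5 (by omega)]

theorem candSet_subset : D.candSet t ⊆ Finset.range D.n := by
  classical exact Finset.filter_subset _ _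

theorem sum_candSet (f : ℕ → ℤ) :
    ∑ k ∈ D.candSet t, f k = ∑ k ∈ Finset.range D.n, ind (D.InCand t k) * f k := by
  classical
  rw [candSet, Finset.sum_filter]
  refine Finset.sum_congr rfl fun k _ => ?_
  by_cases h : D.InCand t k <;> simp [h, ind]

theorem abs_sum_ind_le {f : ℕ → ℤ} (h0 : ∀ k, 0 ≤ f k) (hG : ∀ k, f k ≤ G) (hM : D.n * G ≤ M)
    {i : ℕ} (hi : i ≤ D.n) (P : ℕ → Prop) :
    |∑ k ∈ Finset.range i, ind (P k) * f k| ≤ M := by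
  have hG0 : 0 ≤ G := (h0 0).trans (hG 0)
  rw [abs_of_nonneg (Finset.sum_nonneg fun k _ => mul_nonneg (ind_nonneg _) (h0 k))]
  have h1 : ∑ k ∈ Finset.range i, ind (P k) * f k ≤ ∑ k ∈ Finset.range i, G :=
    Finset.sum_le_sum fun k _ => by
      nlinarith [ind_nonneg (P k), ind_le_one (P k), h0 k, hG k]
  have h2 : (i : ℤ) * G ≤ D.n * G := mul_le_mul_of_nonneg_right (by exact_mod_cast hi) hG0
  simp only [Finset.sum_const, Finset.card_range, nsmul_eq_mul] at h1
  linarith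

end Scaled

/-! #### The program -/

/-- Number of items. -/
def nE : Expr := rd 5 (.const 0)
/-- Number of guessed items. -/
def mE : Expr := rd 5 (.const 1)
/-- Right-hand side of the scaled constraint. -/
def thrE : Expr := rd 5 (.const 2)
/-- Factor on the left-hand side of the scaled constraint. -/
def denE : Expr := rd 5 (.const 3)
/-- Digit number `i` of the current tuple. -/
def digE (i : ℤ) : Expr := rd 2 (.const i)
/-- Entry of the scaled vector `p`. -/
def pE (i : Expr) : Expr := rd 1 (.mul (.const 3) i)
/-- Entry of the scaled vector `q`. -/
def qE (i : Expr) : Expr := rd 1 (.add (.mul (.const 3) i) (.const 1))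
/-- Entry of the scaled vector `c`. -/
def cE (i : Expr) : Expr := rd 1 (.add (.mul (.const 3) i) (.const 2))
/-- First coordinate of a critical vector. -/
def dirXE (i j : Expr) : Expr := .sub (.mul (cE i) (qE j)) (.mul (cE j) (qE i))
/-- Second coordinate of a critical vector. -/
def dirYE (i j : Expr) : Expr := .sub (.mul (cE j) (pE i)) (.mul (cE i) (pE j))
/-- Gain of an item in the direction held by the variables `1` and `2`. -/
def gainE (i : Expr) : Expr := .add (.mul (var 1) (pE i)) (.mul (var 2) (qE i))
/-- The number whose sign decides whether the current item comes before the last one. -/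
def beforeE : Expr :=
  .add (.sub (.add (.mul (.sub (.mul (cE (digE 4)) (gainE (var 0)))
    (.mul (cE (var 0)) (gainE (digE 4)))) (.add nE (.const 2))) (digE 4)) (var 0)) (.const 1)

/-- Mark the forced items in the array `3`. -/
def markProg : Prog :=
  .seq (forTo 0 nE (wr 3 (var 0) (.const 0)))
    (forTo 0 mE (wr 3 (rd 2 (.add (.const 6) (var 0))) (.const 1)))

/-- Mark the current item if it belongs to the candidate. -/
def itemProg : Prog :=
  .ite (.sub (.const 1) (cE (var 0))) (wr 3 (var 0) (.const 1))
    (.ite (.add (.sub (cE (digE 5)) (cE (var 0))) (.const 1))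
      (.ite beforeE (wr 3 (var 0) (.const 1)) .skip) .skip)

/-- Add the current item, if it is marked, to the sums in the variables `3`, `4`, `5`. -/
def addProg : Prog :=
  .seq (setVar 3 (.add (var 3) (.mul (rd 3 (var 0)) (pE (var 0)))))
    (.seq (setVar 4 (.add (var 4) (.mul (rd 3 (var 0)) (qE (var 0)))))
      (setVar 5 (.add (var 5) (.mul (rd 3 (var 0)) (cE (var 0))))))

/-- Compute the candidate, its vector and its cost. -/
def sumProg : Prog :=
  .seq (setVar 1 (.add (dirXE (digE 0) (digE 1)) (dirXE (digE 2) (digE 3))))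
    (.seq (setVar 2 (.add (dirYE (digE 0) (digE 1)) (dirYE (digE 2) (digE 3))))
      (.seq (setVar 3 (.const 0)) (.seq (setVar 4 (.const 0)) (.seq (setVar 5 (.const 0))
        (forTo 0 nE (.seq itemProg addProg))))))

/-- Keep the candidate if it is feasible and is the first such one or cheaper than the best so
far. -/
def keepProg : Prog :=
  .ite (.add (.sub (.mul denE (.add (.mul (var 3) (var 3)) (.mul (var 4) (var 4)))) thrE)
      (.const 1))
    (.ite (.mul (var 6) (.sub (var 6) (var 5)))
      (.seq (setVar 6 (var 5)) (forTo 0 nE (wr 4 (var 0) (rd 3 (var 0))))) .skip) .skip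

/-- Pass to the next tuple of digits; at the end the variable `7` holds the carry. -/
def nextProg : Prog :=
  .seq (setVar 7 (.const 1))
    (forTo 0 (.add mE (.const 6)) (.seq (wr 2 (var 0) (.add (rd 2 (var 0)) (var 7)))
      (.ite (.sub (rd 2 (var 0)) (.add nE (.const 1))) (wr 2 (var 0) (.const 0))
        (setVar 7 (.const 0)))))

/-- Try all tuples of digits. -/
def searchProg : Prog :=
  .loop (.sub (.const 1) (var 7)) (.seq markProg (.seq sumProg (.seq keepProg nextProg)))

/-! #### Its correctness -/

namespace Scaled

variable {D : Scaled} {β : ℕ → ℤ} {b G : ℤ} {s : Mem} {t : ℕ → ℕ} {M : ℕ}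

theorem runs_markProg (hM : D.Fits G M) (hs : D.Ctx β b s) (ht : D.Digits t s) :
    Runs M markProg s (3 * D.n + 3 * D.m + 4) fun s' => D.Ctx β b s' ∧ D.Digits t s' ∧
      ∀ k < D.n, mget s' 3 k = ind (∃ j < D.m, t (6 + j) = k) := by
  have hle := hM.le
  have h1 : |(1 : ℤ)| ≤ M := by simp; omega
  refine Runs.mono (T₁ := (D.n * (1 + 2) + 2) + (D.m * (1 + 2) + 2)) (Runs.seq ?_) (by omega)
    fun _ h => h
  refine Runs.forTo (fun i s => (D.Ctx β b s ∧ D.Digits t s) ∧ ∀ k < i, mget s 3 k = 0) D.n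
    (by decide) (by decide) (by omega) (fun i s h => by simp [nE, h.1.1.n]) ?_ ?_ ?_ ?_
  · rintro i s x ⟨⟨h1, h2⟩, h3⟩
    exact ⟨⟨h1.mset _ (by simp), h2.mset _ _ (by simp)⟩, by simpa using h3⟩
  · exact ⟨⟨hs, ht⟩, by simp⟩
  · rintro i hi s hv ⟨⟨h1, h2⟩, h3⟩
    refine Runs.wr (k := i) (v := 0) (by decide) (by simp [hv]) rfl (by simp)
      ⟨by simpa using hv, ⟨h1.mset _ (by simp), h2.mset _ _ (by simp)⟩, fun k hk => ?_⟩
    simp only [mget_mset, Nat.cast_inj]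
    split_ifs with h
    · rfl
    · exact h3 k (by omega)
  · rintro s ⟨⟨hs, ht⟩, hx⟩
    refine Runs.forTo (fun i s => (D.Ctx β b s ∧ D.Digits t s) ∧
      ∀ k < D.n, mget s 3 k = ind (∃ j < i, t (6 + j) = k)) D.m
      (by decide) (by decide) (by omega) (fun i s h => by simp [mE, h.1.1.m]) ?_ ?_ ?_ ?_
    · rintro i s x ⟨⟨h1, h2⟩, h3⟩
      exact ⟨⟨h1.mset _ (by simp), h2.mset _ _ (by simp)⟩, by simpa using h3⟩
    · exact ⟨⟨hs, ht⟩, fun k hk => by rw [hx k hk, ind_of_false (by simp)]⟩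
    · rintro i hi s hv ⟨⟨h2, h3⟩, h4⟩
      have h6 : mget s 2 (6 + i) = t (6 + i) := by exact_mod_cast h3 (6 + i) (by omega)
      refine Runs.wr (k := t (6 + i)) (v := 1) (by decide) (by simp [hv, h6]) rfl h1
        ⟨by simpa using hv, ⟨h2.mset _ (by simp), h3.mset _ _ (by simp)⟩, fun k hk => ?_⟩
      simp only [mget_mset, Nat.cast_inj]
      split_ifs with h
      · exact (ind_of_true ⟨i, by omega, h.symm⟩).symm
      · rw [h4 k hk]
        congr 1
        rw [eq_iff_iff]
        constructor
        · rintro ⟨j, hj, hjk⟩; exact ⟨j, by omega, hjk⟩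
        · rintro ⟨j, hj, hjk⟩
          refine ⟨j, ?_, hjk⟩
          rcases Nat.lt_succ_iff_lt_or_eq.1 hj with h' | rfl
          · exact h'
          · exact absurd hjk.symm h
    · rintro s ⟨⟨h1, h2⟩, h3⟩
      exact ⟨h1, h2, h3⟩

theorem abs_dir_le (hD : D.Proper) (hM : D.Fits G M) (i j i' j' : ℕ) :
    |D.dirX i j + D.dirX i' j'| ≤ M ∧ |D.dirY i j + D.dirY i' j'| ≤ M := by
  have key : ∀ {f : ℕ → ℤ}, (∀ k, 0 ≤ f k) → (∀ k, f k ≤ G) → ∀ i j,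
      0 ≤ D.c i * f j ∧ D.c i * f j ≤ G ^ 2 := fun {f} h0 h1 i j =>
    ⟨mul_nonneg (hD.c_nonneg i) (h0 j), by
      rw [sq]
      exact mul_le_mul (hM.c_le i) (h1 j) (h0 j) ((h0 0).trans (h1 0))⟩
  have hp := key hD.p_nonneg hM.p_le
  have hq := key hD.q_nonneg hM.q_le
  have hsq := hM.sq_le
  simp only [dirX, dirY]
  constructor
  · have h1 := hq i j
    have h2 := hq j i
    have h3 := hq i' j'
    have h4 := hq j' i'
    rw [abs_le]; constructor <;> linarith
  · have h1 := hp i j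
    have h2 := hp j i
    have h3 := hp i' j'
    have h4 := hp j' i'
    rw [abs_le]; constructor <;> linarith

/-- Contents of the memory while the sums over the items of a candidate are computed, with `i`
items done. -/
structure Summing (D : Scaled) (β : ℕ → ℤ) (b : ℤ) (t : ℕ → ℕ) (i : ℕ) (s : Mem) : Prop
    extends D.Ctx β b s where
  dig : D.Digits t s
  x : mget s 0 1 = D.dirX (t 0) (t 1) + D.dirX (t 2) (t 3)
  y : mget s 0 2 = D.dirY (t 0) (t 1) + D.dirY (t 2) (t 3)
  done : ∀ k < i, mget s 3 k = ind (D.InCand t k)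
  todo : ∀ k < D.n, i ≤ k → mget s 3 k = ind (∃ j < D.m, t (6 + j) = k)
  sp : mget s 0 3 = ∑ k ∈ Finset.range i, ind (D.InCand t k) * D.p k
  sq : mget s 0 4 = ∑ k ∈ Finset.range i, ind (D.InCand t k) * D.q k
  sc : mget s 0 5 = ∑ k ∈ Finset.range i, ind (D.InCand t k) * D.c k

theorem Summing.mset_counter {i : ℕ} (h : D.Summing β b t i s) (v : ℤ) :
    D.Summing β b t i (mset s 0 0 v) where
  toCtx := h.toCtx.mset v (by simp)
  dig := h.dig.mset _ _ (by simp)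
  x := by simpa using h.x
  y := by simpa using h.y
  done := by simpa using h.done
  todo := by simpa using h.todo
  sp := by simpa using h.sp
  sq := by simpa using h.sq
  sc := by simpa using h.sc

theorem Digits.get {j : ℕ} (h : D.Digits t s) (hj : j < 6) : mget s 2 j = t j := h j (by omega)

theorem runs_itemProg (hM : D.Fits G M) {i : ℕ} (hi : i < D.n) (hv : mget s 0 0 = i)
    (h : D.Summing β b t i s) :
    Runs M itemProg s 4 fun s' => s' = mset s 3 i (ind (D.InCand t i)) := by
  have hle := hM.le
  have h1 : |(1 : ℤ)| ≤ M := by simp; omega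
  have hci : (cE (var 0)).eval s = D.c i := by simp [cE, hv, h.c]
  have h4 : mget s 2 4 = t 4 := h.dig.get (j := 4) (by omega)
  have h5 : mget s 2 5 = t 5 := h.dig.get (j := 5) (by omega)
  have hcθ : (cE (digE 5)).eval s = D.c (t 5) := by simp [cE, digE, h5, h.c]
  have hbefore : 0 < beforeE.eval s ↔ D.Before (D.dirX (t 0) (t 1) + D.dirX (t 2) (t 3))
      (D.dirY (t 0) (t 1) + D.dirY (t 2) (t 3)) i (t 4) := by
    simp [beforeE, cE, pE, qE, gainE, digE, nE, hv, h4, h.n, h.p, h.q, h.c, h.x, h.y, Before, adv,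
      gain]
  -- if the item is not marked now, its old mark is right
  have hkeep : (¬ D.c i ≤ 0) → ¬ (D.c i ≤ D.c (t 5) ∧
      D.Before (D.dirX (t 0) (t 1) + D.dirX (t 2) (t 3))
        (D.dirY (t 0) (t 1) + D.dirY (t 2) (t 3)) i (t 4)) →
      s = mset s 3 i (ind (D.InCand t i)) := fun ha hb => by
    have : ind (D.InCand t i) = mget s 3 i := by
      rw [h.todo i hi le_rfl]
      congr 1
      simp only [InCand, ha, hb, or_false]
    rw [this, mset, mget, Function.update_eq_self]
  refine Runs.ite (T := 3) (by decide) (fun he => ?_) (fun he => ?_)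
  · rw [eval_sub, hci, eval_const] at he
    exact (Runs.wr (k := i) (v := 1) (by decide) (by simp [hv]) rfl h1 (by
      rw [ind_of_true (P := D.InCand t i) (Or.inr (Or.inl (by omega)))])).mono (by norm_num)
      fun _ h => h
  · rw [eval_sub, hci, eval_const] at he
    refine Runs.ite (T := 2) (by decide) (fun he' => ?_) (fun he' => ?_)
    · rw [eval_add, eval_sub, hci, hcθ, eval_const] at he'
      refine Runs.ite (T := 1) (by decide) (fun hb => ?_) (fun hb => ?_)
      · exact Runs.wr (k := i) (v := 1) (by decide) (by simp [hv]) rfl h1 (by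
          rw [ind_of_true (P := D.InCand t i) (Or.inr (Or.inr ⟨by omega, hbefore.1 hb⟩))])
      · exact Runs.skip (hkeep (by omega) fun hc => hb (hbefore.2 hc.2))
    · rw [eval_add, eval_sub, hci, hcθ, eval_const] at he'
      exact Runs.mono (T₁ := 1) (Runs.skip (hkeep (by omega) fun hc => by omega)) (by norm_num)
        fun _ h => h

theorem runs_sumProg (hD : D.Proper) (hM : D.Fits G M) (hs : D.Ctx β b s) (ht : D.Digits t s)
    (hx : ∀ k < D.n, mget s 3 k = ind (∃ j < D.m, t (6 + j) = k)) :
    Runs M sumProg s (9 * D.n + 7) fun s' => D.Summing β b t D.n s' := by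
  have hle := hM.le
  have t0 : ∀ {s}, D.Digits t s → mget s 2 0 = t 0 := fun h => h.get (j := 0) (by omega)
  have t1 : ∀ {s}, D.Digits t s → mget s 2 1 = t 1 := fun h => h.get (j := 1) (by omega)
  have t2 : ∀ {s}, D.Digits t s → mget s 2 2 = t 2 := fun h => h.get (j := 2) (by omega)
  have t3 : ∀ {s}, D.Digits t s → mget s 2 3 = t 3 := fun h => h.get (j := 3) (by omega)
  have hdir := abs_dir_le hD hM (t 0) (t 1) (t 2) (t 3)
  refine Runs.mono (T₁ := D.n * (7 + 2) + 2 + 1 + 1 + 1 + 1 + 1) ?_ (by omega) fun _ h => h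
  refine Runs.setVar_seq _ (by decide)
    (by simp [dirXE, cE, qE, digE, t0 ht, t1 ht, t2 ht, t3 ht, hs.c, hs.q]; rfl) hdir.1 ?_
  have hs1 := hs.mset (a := 0) (k := 1) (D.dirX (t 0) (t 1) + D.dirX (t 2) (t 3)) (by simp)
  have ht1 := ht.mset (a := 0) 1 (D.dirX (t 0) (t 1) + D.dirX (t 2) (t 3)) (by simp)
  refine Runs.setVar_seq (D.dirY (t 0) (t 1) + D.dirY (t 2) (t 3)) (by decide)
    (by simp only [dirYE, cE, pE, digE, t0 ht1, t1 ht1, t2 ht1, t3 ht1, hs1.c, hs1.p, eval_add,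
          eval_sub, eval_mul, eval_rd, eval_const]; rfl) hdir.2 ?_
  refine Runs.setVar_seq 0 (by decide) rfl (by simp) ?_
  refine Runs.setVar_seq 0 (by decide) rfl (by simp) ?_
  refine Runs.setVar_seq 0 (by decide) rfl (by simp) ?_
  refine Runs.forTo (fun i s => D.Summing β b t i s) D.n (by decide) (by decide) (by omega)
    (fun i s h => by simp [nE, h.n]) (fun i s x h => h.mset_counter x) ?_ ?_ (fun _ h => h)
  · constructor
    · exact (((hs1.mset _ (by simp)).mset _ (by simp)).mset _ (by simp)).mset _ (by simp)
    · exact (((ht1.mset _ _ (by simp)).mset _ _ (by simp)).mset _ _ (by simp)).mset _ _ (by simp)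
    · simp
    · simp
    · simp
    · simpa using hx
    · simp
    · simp
    · simp
  · intro i hi s hv h
    refine Runs.mono (T₁ := 4 + 3) (Runs.seq ((runs_itemProg hM hi hv h).mono le_rfl ?_)) le_rfl
      fun _ h => h
    rintro _ rfl
    have bound := fun {f : ℕ → ℤ} (h0 : ∀ k, 0 ≤ f k) (hG : ∀ k, f k ≤ G) =>
      abs_sum_ind_le h0 hG hM.mul_le (i := i + 1) hi (D.InCand t)
    refine Runs.setVar_seq (∑ k ∈ Finset.range (i + 1), ind (D.InCand t k) * D.p k) (by decide) ?_
      (bound hD.p_nonneg hM.p_le) ?_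
    · simp [pE, hv, h.p, h.sp, Finset.sum_range_succ]
    refine Runs.setVar_seq (∑ k ∈ Finset.range (i + 1), ind (D.InCand t k) * D.q k) (by decide) ?_
      (bound hD.q_nonneg hM.q_le) ?_
    · simp [qE, hv, h.q, h.sq, Finset.sum_range_succ]
    refine Runs.setVar (∑ k ∈ Finset.range (i + 1), ind (D.InCand t k) * D.c k) (by decide) ?_
      (bound hD.c_nonneg hM.c_le) ?_
    · simp [cE, hv, h.c, h.sc, Finset.sum_range_succ]
    refine ⟨by simpa using hv, ?_⟩
    constructor
    · exact (((h.toCtx.mset _ (by simp)).mset _ (by simp)).mset _ (by simp)).mset _ (by simp)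
    · exact (((h.dig.mset _ _ (by simp)).mset _ _ (by simp)).mset _ _ (by simp)).mset _ _ (by simp)
    · simpa using h.x
    · simpa using h.y
    · intro k hk
      by_cases hki : k = i
      · simp [hki]
      · have hne : (k : ℤ) ≠ i := by omega
        simpa [hne] using h.done k (by omega)
    · intro k hk hki
      have := h.todo k hk (by omega)
      have hne : (k : ℤ) ≠ i := by omega
      simpa [hne] using this
    · simp
    · simp
    · simp

theorem runs_keepProg (hM : D.Fits G M) (hD : D.Proper) {F : Set (Finset ℕ)}
    (hb : D.Best F β b) (h : D.Summing β b t D.n s) :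
    Runs M keepProg s (3 * D.n + 5) fun s' => D.Digits t s' ∧
      ∃ β' b', D.Ctx β' b' s' ∧ D.Best (insert (D.candSet t) F) β' b' := by
  have hle := hM.le
  have hp := h.sp
  have hq := h.sq
  have hc := h.sc
  have hbound : |mget s 0 5| ≤ M := by
    rw [hc]; exact abs_sum_ind_le hD.c_nonneg hM.c_le hM.mul_le le_rfl _
  rw [← sum_candSet] at hp hq hc
  have hc0 : 0 ≤ mget s 0 5 := hc ▸ Finset.sum_nonneg fun k _ => hD.c_nonneg k
  have hb1 : -1 ≤ b := by
    rcases hb.attained with h | ⟨X, -, -, h, -⟩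
    · exact h.ge
    · have : 0 ≤ b := h ▸ Finset.sum_nonneg fun k _ => hD.c_nonneg k
      omega
  have h6 := h.cost
  have hfeas : 0 < (Expr.add (.sub (.mul denE (.add (.mul (var 3) (var 3))
      (.mul (var 4) (var 4)))) thrE) (.const 1)).eval s ↔ D.Feas (D.candSet t) := by
    have : (Expr.add (.sub (.mul denE (.add (.mul (var 3) (var 3))
      (.mul (var 4) (var 4)))) thrE) (.const 1)).eval s = D.den * ((∑ k ∈ D.candSet t, D.p k) ^ 2 +
        (∑ k ∈ D.candSet t, D.q k) ^ 2) - D.thr + 1 := by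
      simp [denE, thrE, h.den, h.thr, hp, hq, sq]
    rw [this, Feas]
    omega
  refine Runs.ite (T := 3 * D.n + 4) (by decide) (fun hf => ?_) (fun hf => ?_)
  · rw [hfeas] at hf
    refine Runs.ite (T := 3 * D.n + 3) (by decide) (fun hlt => ?_) (fun hlt => ?_)
    · have hlt' : 0 < b * (b - mget s 0 5) := by simpa [h6] using hlt
      refine Runs.mono (T₁ := D.n * (1 + 2) + 2 + 1) (Runs.setVar_seq (mget s 0 5) (by decide) rfl
        hbound ?_) (by omega) fun _ h => h
      have hEnv : ∀ {s' : Mem}, (∃ a k v s, D.Env s ∧ (a = 0 ∨ a = 4) ∧ s' = mset s a k v) →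
          D.Env s' := by
        rintro s' ⟨a, k, v, s, hs, ha, rfl⟩
        exact hs.mset _ _ (by omega)
      refine Runs.forTo (fun i s' => D.Env s' ∧ D.Digits t s' ∧
          mget s' 0 6 = ∑ k ∈ D.candSet t, D.c k ∧
          (∀ k < D.n, mget s' 3 k = ind (D.InCand t k)) ∧
          (∀ k < i, mget s' 4 k = ind (D.InCand t k)))
        D.n (by decide) (by decide) (by omega) (fun i s h => by simp [nE, h.1.n]) ?_ ?_ ?_ ?_
      · rintro i s x ⟨h1, h2, h3, h4, h5⟩
        exact ⟨hEnv ⟨_, _, _, _, h1, .inl rfl, rfl⟩, h2.mset _ _ (by simp), by simpa using h3,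
          by simpa using h4, by simpa using h5⟩
      · exact ⟨hEnv ⟨_, _, _, _, h.toEnv, .inl rfl, rfl⟩, h.dig.mset _ _ (by simp),
          by simpa using hc, by simpa using h.done, by simp⟩
      · rintro i hi s hv ⟨h1, h2, h3, h4, h5⟩
        refine Runs.wr (k := i) (v := ind (D.InCand t i)) (by decide) (by simp [hv])
          (by simp [hv, h4 i hi]) ((abs_ind_le _).trans (by omega)) ⟨by simpa using hv,
          hEnv ⟨_, _, _, _, h1, .inr rfl, rfl⟩, h2.mset _ _ (by simp), by simpa using h3,
          by simpa using h4, fun k hk => ?_⟩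
        simp only [mget_mset, Nat.cast_inj]
        split_ifs with hki
        · rw [hki]
        · exact h5 k (by omega)
      · rintro s' ⟨h1, h2, h3, h4, h5⟩
        refine ⟨h2, fun k => mget s' 4 k, _, ⟨h1, fun _ => rfl, h3⟩, ?_⟩
        constructor
        · refine .inr ⟨D.candSet t, candSet_subset, hf, rfl, fun k hk => ?_⟩
          rw [h5 k hk]
          congr 1
          simp [candSet, hk]
        · rintro X (rfl | hX) hXf
          · exact ⟨hc ▸ hc0, le_rfl⟩
          · obtain ⟨h7, h8⟩ := hb.le X hX hXf
            refine ⟨hc ▸ hc0, ?_⟩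
            rw [← hc]
            by_contra! hcon
            nlinarith
    · have hlt' : ¬ 0 < b * (b - mget s 0 5) := by simpa [h6] using hlt
      refine (Runs.skip ⟨h.dig, β, b, h.toCtx, hb.attained, ?_⟩).mono (by omega) fun _ h => h
      rintro X (rfl | hX) hXf
      · rw [← hc]
        have hb0 : b ≠ -1 := by
          rintro rfl
          exact hlt' (by linarith)
        refine ⟨by omega, ?_⟩
        by_contra! hcon
        exact hlt' (mul_pos (by omega) (by linarith))
      · exact hb.le X hX hXf
  · rw [hfeas] at hf
    refine (Runs.skip ⟨h.dig, β, b, h.toCtx, hb.attained, ?_⟩).mono (by omega) fun _ h => h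
    rintro X (rfl | hX) hXf
    · exact absurd hXf hf
    · exact hb.le X hX hXf

/-- Digit number `j` of `N` in base `B`. -/
def digit (B N j : ℕ) : ℕ := N / B ^ j % B

theorem digit_lt {B : ℕ} (hB : 0 < B) (N j : ℕ) : digit B N j < B := Nat.mod_lt _ hB

theorem digit_succ_of_not_dvd {B N j : ℕ} (h : ¬ B ^ j ∣ N + 1) :
    digit B (N + 1) j = digit B N j := by
  rw [digit, digit, Nat.succ_div_of_not_dvd h]

theorem digit_succ_of_dvd {B N j : ℕ} (hB : 2 ≤ B) (h : B ^ j ∣ N + 1) :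
    (B ≤ digit B N j + 1 → digit B (N + 1) j = 0 ∧ B ^ (j + 1) ∣ N + 1) ∧
    (digit B N j + 1 < B → digit B (N + 1) j = digit B N j + 1 ∧ ¬ B ^ (j + 1) ∣ N + 1) := by
  have hlt := digit_lt (by omega : 0 < B) N j
  have hdiv : (N + 1) / B ^ j = N / B ^ j + 1 := Nat.succ_div_of_dvd h
  have hmod : digit B (N + 1) j = (digit B N j + 1) % B := by
    rw [digit, digit, hdiv, Nat.mod_add_mod]
  have hpos : 0 < B ^ j := Nat.pow_pos (by omega)
  have hdvd : B ^ (j + 1) ∣ N + 1 ↔ digit B (N + 1) j = 0 := by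
    rw [digit, ← Nat.dvd_iff_mod_eq_zero, pow_succ]
    exact (Nat.dvd_div_iff_mul_dvd h).symm
  rw [hdvd, hmod]
  constructor
  · intro hge
    have : digit B N j + 1 = B := by omega
    simp [this]
  · intro hlt'
    rw [Nat.mod_eq_of_lt hlt']
    simp

theorem exists_digits {B : ℕ} (hB : 0 < B) (t : ℕ → ℕ) (ht : ∀ j, t j < B) (m : ℕ) :
    ∃ N < B ^ m, ∀ j < m, digit B N j = t j := by
  induction m generalizing t with
  | zero => exact ⟨0, by simp, by simp⟩
  | succ m ih =>
    obtain ⟨N, hN, h⟩ := ih (fun j => t (j + 1)) fun j => ht _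
    refine ⟨t 0 + B * N, ?_, ?_⟩
    · have := ht 0
      have : B * (N + 1) ≤ B * B ^ m := Nat.mul_le_mul_left _ hN
      rw [pow_succ']
      linarith
    · rintro (_ | j) hj
      · simp [digit, Nat.mod_eq_of_lt (ht 0)]
      · have hdiv : (t 0 + B * N) / B = N := by
          rw [Nat.add_mul_div_left _ _ hB, Nat.div_eq_of_lt (ht 0), zero_add]
        rw [digit, pow_succ', ← Nat.div_div_eq_div_mul, hdiv]
        exact h j (by omega)

theorem runs_nextProg (hM : D.Fits G M) {N : ℕ} (hs : D.Ctx β b s)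
    (ht : D.Digits (digit (D.n + 2) N) s) :
    Runs M nextProg s (5 * D.m + 33) fun s' => D.Ctx β b s' ∧
      D.Digits (digit (D.n + 2) (N + 1)) s' ∧
      mget s' 0 7 = ind ((D.n + 2) ^ (D.m + 6) ∣ N + 1) := by
  have hle := hM.le
  have h1 : |(1 : ℤ)| ≤ M := by simp; omega
  refine Runs.mono (T₁ := (D.m + 6) * (3 + 2) + 2 + 1) (Runs.setVar_seq 1 (by decide) rfl h1 ?_)
    (by omega) fun _ h => h
  refine Runs.forTo (fun i s => D.Ctx β b s ∧ mget s 0 7 = ind ((D.n + 2) ^ i ∣ N + 1) ∧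
      (∀ j < i, mget s 2 j = digit (D.n + 2) (N + 1) j) ∧
      ∀ j < D.m + 6, i ≤ j → mget s 2 j = digit (D.n + 2) N j) (D.m + 6)
    (by decide) (by decide) (by omega) (fun i s h => by simp [mE, h.1.m]) ?_ ?_ ?_ ?_
  · rintro i s x ⟨h1, h2, h3, h4⟩
    exact ⟨h1.mset _ (by simp), by simpa using h2, by simpa using h3, by simpa using h4⟩
  · exact ⟨hs.mset _ (by simp), by simp [ind], by simp, fun j hj _ => by simpa using ht j hj⟩
  · rintro i hi s hv ⟨h2, h3, h4, h5⟩
    have hdi := h5 i hi le_rfl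
    have hlt := digit_lt (by omega : 0 < D.n + 2) N i
    set δ := digit (D.n + 2) N i with hδ
    set κ := ind ((D.n + 2) ^ i ∣ N + 1) with hκ
    have hκ0 : 0 ≤ κ := ind_nonneg _
    have hκ1 : κ ≤ 1 := ind_le_one _
    refine Runs.wr_seq (T := 2) i (δ + κ) (by decide) (by simp [hv]) (by simp [hv, hdi, h3])
      (by rw [abs_of_nonneg (by omega)]; omega) ?_
    have ht' : (Expr.sub (rd 2 (var 0)) (.add nE (.const 1))).eval (mset s 2 i (δ + κ)) =
        δ + κ - (D.n + 1) := by
      simp [hv, nE, h2.n]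
    have rest : ∀ v : ℤ, v = digit (D.n + 2) (N + 1) i → ∀ s' : Mem,
        (∀ j, mget s' 2 j = mget (mset s 2 i v) 2 j) →
        (∀ j < i + 1, mget s' 2 j = digit (D.n + 2) (N + 1) j) ∧
        ∀ j < D.m + 6, i + 1 ≤ j → mget s' 2 j = digit (D.n + 2) N j := by
      rintro v hv' s' hs'
      refine ⟨fun j hj => ?_, fun j hj hij => ?_⟩
      · rw [hs', mget_mset]
        split_ifs with hji
        · rw [Nat.cast_inj] at hji; rw [hv', hji]
        · exact h4 j (by omega)
      · rw [hs', mget_mset, if_neg (by omega)]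
        exact h5 j hj (by omega)
    refine Runs.ite (T := 1) (by decide) (fun he => ?_) (fun he => ?_)
    · rw [ht'] at he
      have hdvd : (D.n + 2) ^ i ∣ N + 1 := by
        by_contra hcon
        rw [hκ, ind_of_false hcon] at he
        omega
      have hκ' : κ = 1 := ind_of_true hdvd
      obtain ⟨h6, h7⟩ := (digit_succ_of_dvd (by omega) hdvd).1 (by rw [← hδ]; omega)
      refine Runs.wr (k := i) (v := 0) (by decide) (by simp [hv]) rfl (by simp)
        ⟨by simpa using hv, (h2.mset _ (by simp)).mset _ (by simp), ?_, rest 0 (by simp [h6]) _ ?_⟩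
      · simp [h3, hκ', ind_of_true h7]
      · intro j; simp only [mget_mset]; split_ifs <;> rfl
    · rw [ht'] at he
      have hd : (δ : ℤ) + κ = digit (D.n + 2) (N + 1) i ∧ ¬ (D.n + 2) ^ (i + 1) ∣ N + 1 := by
        by_cases hdvd : (D.n + 2) ^ i ∣ N + 1
        · have hκ' : κ = 1 := ind_of_true hdvd
          obtain ⟨h6, h7⟩ := (digit_succ_of_dvd (by omega) hdvd).2 (by rw [← hδ]; omega)
          exact ⟨by rw [h6, hκ', hδ]; push_cast; rfl, h7⟩
        · have hκ' : κ = 0 := ind_of_false hdvd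
          refine ⟨by rw [digit_succ_of_not_dvd hdvd, hκ', hδ, add_zero], fun h => hdvd ?_⟩
          exact (Nat.pow_dvd_pow _ (by omega)).trans h
      refine Runs.setVar 0 (by decide) rfl (by simp)
        ⟨by simpa using hv, (h2.mset _ (by simp)).mset _ (by simp), ?_, rest _ hd.1 _ ?_⟩
      · simp [ind_of_false hd.2]
      · intro j; simp
  · rintro s ⟨h1, h2, h3, h4⟩
    exact ⟨h1, h3, h2⟩

theorem runs_searchProg (hD : D.Proper) (hM : D.Fits G M) (hs : D.Ctx β (-1) s)
    (h0 : ∀ j : ℕ, mget s 2 j = 0) (h7 : mget s 0 7 = 0) :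
    Runs M searchProg s ((D.n + 2) ^ (D.m + 6) * (15 * D.n + 8 * D.m + 50) + 1) fun s' =>
      ∃ β' b', D.Ctx β' b' s' ∧
        D.Best {X | ∃ t : ℕ → ℕ, (∀ j, t j < D.n + 2) ∧ X = D.candSet t} β' b' := by
  set B := D.n + 2 with hB
  refine Runs.loop (T := 15 * D.n + 8 * D.m + 49) (fun i s => D.Digits (digit B i) s ∧
      mget s 0 7 = ind (i = B ^ (D.m + 6)) ∧
      ∃ β b, D.Ctx β b s ∧ D.Best {X | ∃ N < i, X = D.candSet (digit B N)} β b)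
    (B ^ (D.m + 6)) (by decide) ?_ ?_
  · rintro i s hi ⟨h1, h2, β, b, h3, h4⟩
    have he : (Expr.sub (.const 1) (var 7)).eval s = 1 - ind (i = B ^ (D.m + 6)) := by simp [h2]
    rw [he]
    rcases hi.eq_or_lt with h | h
    · left
      rw [ind_of_true h]
      refine ⟨by simp, β, b, h3, h4.attained, ?_⟩
      rintro X ⟨t, ht, rfl⟩
      obtain ⟨N, hN, hNt⟩ := exists_digits (by omega : 0 < B) t ht (D.m + 6)
      exact h4.le _ ⟨N, by omega, candSet_congr fun j hj => (hNt j hj).symm⟩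
    · right
      rw [ind_of_false h.ne]
      refine ⟨h, by simp, Runs.mono (T₁ := (3 * D.n + 3 * D.m + 4) + ((9 * D.n + 7) +
        ((3 * D.n + 5) + (5 * D.m + 33)))) (Runs.seq ((runs_markProg hM h3 h1).mono le_rfl ?_))
        (by omega) fun _ h => h⟩
      rintro s1 ⟨h5, h6, h7⟩
      refine Runs.seq ((runs_sumProg hD hM h5 h6 h7).mono le_rfl fun s2 h8 => ?_)
      refine Runs.seq ((runs_keepProg hM hD h4 h8).mono le_rfl ?_)
      rintro s3 ⟨h9, β', b', h10, h11⟩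
      refine (runs_nextProg hM h10 h9).mono le_rfl ?_
      rintro s4 ⟨h12, h13, h14⟩
      refine ⟨h13, ?_, β', b', h12, h11.attained, ?_⟩
      · rw [h14]
        congr 1
        rw [eq_iff_iff]
        constructor
        · intro hd
          exact le_antisymm h (Nat.le_of_dvd (by omega) hd)
        · rintro h; rw [h]
      · rintro X ⟨N, hN, rfl⟩
        refine h11.le _ ?_
        rcases Nat.lt_succ_iff_lt_or_eq.1 hN with h | rfl
        · exact Or.inr ⟨N, h, rfl⟩
        · exact Or.inl rfl
  · refine ⟨fun j hj => by simp [h0, digit], ?_, β, -1, hs, .inl rfl, ?_⟩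
    · rw [h7, ind_of_false (Nat.pow_pos (by omega)).ne]
    · rintro X ⟨N, hN, -⟩
      omega

end Scaled

end MinCKP

/-! ### The input list -/

namespace RAM

theorem sum_bits_getD (l : List ℤ) :
    ∑ z ∈ Finset.range l.length, bits (l.getD z 0) = bitLength l := by
  induction l with
  | nil => simp [bitLength]
  | cons a l ih =>
    rw [List.length_cons, Finset.sum_range_succ']
    simp only [List.getD_cons_succ, List.getD_cons_zero, ih]
    simp [bitLength, add_comm]

theorem bitLength_append (l l' : List ℤ) : bitLength (l ++ l') = bitLength l + bitLength l' := by
  simp [bitLength]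

theorem abs_le_two_pow_bits (z : ℤ) : |z| ≤ 2 ^ bits z := by
  rw [Int.abs_eq_natAbs]
  exact_mod_cast (natAbs_lt_two_pow z).le.trans (Nat.pow_le_pow_right (by norm_num) (by omega))

theorem abs_load_le (l : List ℤ) (z : ℤ) : |load l z| ≤ 2 ^ bitLength l := by
  unfold load
  split_ifs
  · by_cases h : z.toNat < l.length
    · refine (abs_le_two_pow_bits _).trans (pow_le_pow_right₀ (by norm_num) ?_)
      rw [← sum_bits_getD]
      exact Finset.single_le_sum (f := fun z => bits (l.getD z 0)) (fun _ _ => Nat.zero_le _)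
        (Finset.mem_range.2 h)
    · rw [List.getD_eq_default _ _ (by omega)]; simp
  · simp

/-- The product of distinct entries of a list is bounded by its binary length. -/
theorem prod_getD_le (l : List ℤ) (N : ℕ) (f : ℕ → ℕ) (hf : Function.Injective f)
    (hlt : ∀ e < N, f e < l.length) (h0 : ∀ e < N, 0 ≤ l.getD (f e) 0) :
    ∏ e ∈ Finset.range N, l.getD (f e) 0 ≤ 2 ^ bitLength l := by
  calc ∏ e ∈ Finset.range N, l.getD (f e) 0
      ≤ ∏ e ∈ Finset.range N, (2 : ℤ) ^ bits (l.getD (f e) 0) :=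
        Finset.prod_le_prod (fun e he => h0 e (Finset.mem_range.1 he)) fun e _ =>
          (le_abs_self _).trans (abs_le_two_pow_bits _)
    _ = 2 ^ ∑ e ∈ Finset.range N, bits (l.getD (f e) 0) := Finset.prod_pow_eq_pow_sum _ _ _
    _ ≤ _ := by
        refine pow_le_pow_right₀ (by norm_num) ?_
        rw [← sum_bits_getD, ← Finset.sum_image (s := Finset.range N) (g := f)
          (f := fun z => bits (l.getD z 0)) fun a _ b _ h => hf h]
        refine Finset.sum_le_sum_of_subset fun z hz => ?_
        obtain ⟨e, he, rfl⟩ := Finset.mem_image.1 hz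
        exact Finset.mem_range.2 (hlt e (Finset.mem_range.1 he))

theorem getD_flatMap {α : Type*} (f : α → List ℤ) (w : ℕ) (hf : ∀ a, (f a).length = w)
    (l : List α) (i r : ℕ) (hi : i < l.length) (hr : r < w) :
    (l.flatMap f).getD (w * i + r) 0 = (f l[i]).getD r 0 := by
  induction l generalizing i with
  | nil => simp at hi
  | cons a l ih =>
    rw [List.flatMap_cons]
    cases i with
    | zero =>
      rw [List.getD_append _ _ _ _ (by rw [hf]; omega)]
      simp
    | succ i =>
      rw [List.getD_append_right _ _ _ _ (by rw [hf, mul_add]; omega), hf]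
      have : w * (i + 1) + r - w = w * i + r := by rw [mul_add]; omega
      rw [this, ih i (by simpa using hi)]
      simp

end RAM

namespace MinCKP

/-- The list that is given to the algorithm. -/
def input {n : ℕ} (ε : ℚ) (I : Instance n) : List ℤ := encodeRat ε ++ I.encode

theorem length_input {n : ℕ} (ε : ℚ) (I : Instance n) : (input ε I).length = 5 + 6 * n := by
  simp [input, encodeRat, Instance.encode, List.length_flatMap]
  ring

/-- The six numbers that encode an item. -/
def itemList {n : ℕ} (I : Instance n) (i : Fin n) : List ℤ :=
  [(I.p i).num, ((I.p i).den : ℤ), (I.q i).num, ((I.q i).den : ℤ), (I.c i).num, ((I.c i).den : ℤ)]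

theorem input_getD {n : ℕ} (ε : ℚ) (I : Instance n) (i : Fin n) {r : ℕ} (hr : r < 6) :
    (input ε I).getD (6 * i + r + 5) 0 = (itemList I i).getD r 0 := by
  have h : input ε I = ε.num :: (ε.den : ℤ) :: (n : ℤ) :: I.C.num :: (I.C.den : ℤ) ::
    (List.finRange n).flatMap (itemList I) := rfl
  rw [h]
  simp only [List.getD_cons_succ]
  rw [getD_flatMap (itemList I) 6 (fun _ => rfl) _ _ _ (by simp) hr]
  simp

/-! ### Scaling to integers -/

/-- Numerator of the entry number `e` of the instance; the entries are the components of `p`,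
`q` and `c`, item by item. -/
def numer (f : Mem) (e : ℕ) : ℤ := f (5 + 2 * e)

/-- Denominator of the entry number `e` of the instance. -/
def denom (f : Mem) (e : ℕ) : ℤ := f (6 + 2 * e)

/-- The product of all denominators. -/
def scaleFactor (n : ℕ) (f : Mem) : ℤ := ∏ e ∈ Finset.range (3 * n), denom f e

/-- Numerator of the entry number `e` times the first `j` denominators other than its own. -/
def partialEntry (f : Mem) (e j : ℕ) : ℤ :=
  numer f e * ∏ i ∈ Finset.range j, if i = e then 1 else denom f i

/-- The entries times the product of all denominators, followed by the auxiliary vectors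
`(0, 1, 0)` and `(1, 0, 0)`. -/
def entry (n : ℕ) (f : Mem) (e : ℕ) : ℤ :=
  if e < 3 * n then partialEntry f e (3 * n) else if e = 3 * n + 1 ∨ e = 3 * n + 3 then 1 else 0

/-- The instance that is stored in the memory `f`, scaled to integers. -/
def scaled (n m : ℕ) (f : Mem) : Scaled where
  n := n
  m := m
  p k := entry n f (3 * k)
  q k := entry n f (3 * k + 1)
  c k := entry n f (3 * k + 2)
  thr := f 3 * scaleFactor n f * scaleFactor n f
  den := f 4

/-- The cells of the initial memory hold an instance with `n` items, and their contents are bounded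
by `G`, as is the product of the denominators. -/
structure ValidInput (n : ℕ) (f : Mem) (G : ℤ) : Prop where
  eps_pos : 0 < f 0
  epsDen_pos : 0 < f 1
  n_eq : f 2 = n
  n_pos : 0 < n
  thr_pos : 0 < f 3
  den_pos : 0 < f 4
  numer_nonneg : ∀ e < 3 * n, 0 ≤ numer f e
  denom_pos : ∀ e < 3 * n, 1 ≤ denom f e
  abs_le : ∀ z, |f z| ≤ G
  prod_le : scaleFactor n f ≤ G
  neg : ∀ z < 0, f z = 0

variable {n m : ℕ} {f : Mem} {G : ℤ} {M : ℕ}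

theorem partialEntry_mul_denom {e : ℕ} (he : e < 3 * n) :
    partialEntry f e (3 * n) * denom f e = numer f e * scaleFactor n f := by
  have h : denom f e = ∏ i ∈ Finset.range (3 * n), if i = e then denom f i else 1 := by
    rw [Finset.prod_ite_eq', if_pos (Finset.mem_range.2 he)]
  rw [partialEntry, mul_assoc]
  rw [h, ← Finset.prod_mul_distrib, scaleFactor]
  congr 1
  refine Finset.prod_congr rfl fun i _ => ?_
  split_ifs <;> simp

namespace ValidInput

theorem one_le_bound (h : ValidInput n f G) : 1 ≤ G := by
  have := h.abs_le 0
  have := le_abs_self (f 0)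
  have := h.eps_pos
  omega

theorem n_le (h : ValidInput n f G) : (n : ℤ) ≤ G := by
  rw [← h.n_eq]; exact (le_abs_self _).trans (h.abs_le 2)

theorem prod_denom_le (h : ValidInput n f G) {j : ℕ} (hj : j ≤ 3 * n) :
    1 ≤ ∏ i ∈ Finset.range j, denom f i ∧ ∏ i ∈ Finset.range j, denom f i ≤ G := by
  have h1 : ∀ i ∈ Finset.range (3 * n), 1 ≤ denom f i := fun i hi =>
    h.denom_pos i (Finset.mem_range.1 hi)
  have hsub : Finset.range j ⊆ Finset.range (3 * n) := Finset.range_subset_range.2 hj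
  have key : ∀ s ⊆ Finset.range (3 * n), 1 ≤ ∏ i ∈ s, denom f i := fun s hs => by
    rw [← Finset.prod_const_one (s := s)]
    exact Finset.prod_le_prod (fun _ _ => zero_le_one) fun i hi => h1 i (hs hi)
  refine ⟨key _ hsub, le_trans ?_ h.prod_le⟩
  rw [scaleFactor, ← Finset.prod_sdiff hsub]
  have h2 := key _ hsub
  have h3 := key _ (Finset.sdiff_subset : Finset.range (3 * n) \ Finset.range j ⊆ _)
  nlinarith

theorem partialEntry_nonneg (h : ValidInput n f G) {e j : ℕ} (he : e < 3 * n) (hj : j ≤ 3 * n) :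
    0 ≤ partialEntry f e j :=
  mul_nonneg (h.numer_nonneg e he) (Finset.prod_nonneg fun i hi => by
    have := h.denom_pos i (by rw [Finset.mem_range] at hi; omega)
    split_ifs <;> omega)

theorem partialEntry_le (h : ValidInput n f G) {e j : ℕ} (hj : j ≤ 3 * n) :
    partialEntry f e j ≤ G ^ 2 := by
  rw [partialEntry, sq]
  have hden : ∀ i ∈ Finset.range j, 1 ≤ denom f i := fun i hi =>
    h.denom_pos i (by rw [Finset.mem_range] at hi; omega)
  refine mul_le_mul ((le_abs_self _).trans (h.abs_le _)) (le_trans ?_ (h.prod_denom_le hj).2)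
    (Finset.prod_nonneg fun i hi => ?_) (by linarith [h.one_le_bound])
  · refine Finset.prod_le_prod (fun i hi => ?_) fun i hi => ?_
    all_goals
      have := hden i hi
      split_ifs <;> omega
  · have := hden i hi
    split_ifs <;> omega

theorem entry_nonneg (h : ValidInput n f G) (e : ℕ) : 0 ≤ entry n f e := by
  unfold entry
  split_ifs with h1 h2
  · exact h.partialEntry_nonneg h1 le_rfl
  · exact zero_le_one
  · exact le_rfl

theorem entry_le (h : ValidInput n f G) (e : ℕ) : entry n f e ≤ G ^ 2 := by
  have := h.one_le_bound
  unfold entry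
  split_ifs with h1 h2
  · exact h.partialEntry_le le_rfl
  · nlinarith
  · positivity

theorem proper (h : ValidInput n f G) : (scaled n m f).Proper where
  p_nonneg _ := h.entry_nonneg _
  q_nonneg _ := h.entry_nonneg _
  c_nonneg _ := h.entry_nonneg _
  p_n := by simp [scaled, entry]
  q_n := by simp [scaled, entry]
  c_n := by simp [scaled, entry]
  p_n1 := by simp [scaled, entry, mul_add]
  q_n1 := by
    simp only [scaled, entry]
    rw [if_neg (by omega), if_neg (by omega)]
  c_n1 := by
    simp only [scaled, entry]
    rw [if_neg (by omega), if_neg (by omega)]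

theorem fits (h : ValidInput n f G) (hm : m ≤ n) (hM : 16 * G ^ 4 ≤ M) :
    (scaled n m f).Fits (G ^ 2) M where
  p_le _ := h.entry_le _
  q_le _ := h.entry_le _
  c_le _ := h.entry_le _
  sq_le := by
    have : 0 ≤ G ^ 4 := by positivity
    linarith
  mul_le := by
    have h1 := h.one_le_bound
    have h2 : (n : ℤ) * G ^ 2 ≤ G * G ^ 2 := mul_le_mul_of_nonneg_right h.n_le (by positivity)
    have h3 : G ^ 3 ≤ G ^ 4 := pow_le_pow_right₀ h1 (by norm_num)
    have h4 : (0 : ℤ) ≤ G ^ 4 := by positivity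
    simp only [scaled]
    linarith
  le := by
    have h1 := h.one_le_bound
    have h2 : G ≤ G ^ 4 := le_self_pow₀ h1 (by norm_num)
    have h3 := h.n_le
    simp only [scaled]
    omega

end ValidInput

/-! ### Setting up the search -/

/-- Compute the number of items to guess. -/
def guessProg : Prog :=
  forTo 0 nE (.ite (.sub (.cell (.const 1)) (.mul (var 0) (.cell (.const 0))))
    (wr 5 (.const 1) (.add (var 0) (.const 1))) .skip)

/-- The number of entries. -/
def entriesE : Expr := .mul (.const 3) nE

/-- Address of the numerator of an entry. -/
def numAdr (i : Expr) : Expr := .add (.const 5) (.mul (.const 2) i)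

/-- Address of the denominator of an entry. -/
def denAdr (i : Expr) : Expr := .add (.const 6) (.mul (.const 2) i)

/-- Multiply all denominators, in the variable `8`. -/
def factorProg : Prog :=
  .seq (setVar 8 (.const 1)) (forTo 0 entriesE (setVar 8 (.mul (var 8) (.cell (denAdr (var 0))))))

/-- Compute the scaled entries, in the array `1`. -/
def entryProg : Prog :=
  forTo 0 entriesE (.seq (wr 1 (var 0) (.cell (numAdr (var 0))))
    (forTo 9 entriesE (.ite (.mul (.sub (var 9) (var 0)) (.sub (var 9) (var 0)))
      (wr 1 (var 0) (.mul (rd 1 (var 0)) (.cell (denAdr (var 9))))) .skip)))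

/-- Store the auxiliary vectors and the constraint, and note that no solution has been found. -/
def initProg : Prog :=
  .seq (wr 1 (.add entriesE (.const 1)) (.const 1))
    (.seq (wr 1 (.add entriesE (.const 3)) (.const 1))
      (.seq (wr 5 (.const 2) (.mul (.mul (.cell (.const 3)) (var 8)) (var 8)))
        (.seq (wr 5 (.const 3) (.cell (.const 4))) (setVar 6 (.const (-1))))))

/-- All that precedes the search. -/
def setupProg : Prog :=
  .seq (wr 5 (.const 0) (.cell (.const 2)))
    (.seq guessProg (.seq factorProg (.seq entryProg initProg)))

/-- Copy the best solution to the output cells. -/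
def outputProg : Prog := forTo 0 nE (.store (var 0) (rd 4 (var 0)))

/-- The approximation scheme. -/
def schemeProg : Prog := .seq setupProg (.seq searchProg outputProg)

/-- The memory during the set-up: the input is untouched, the number of items is known, and the
cells that the search expects to be zero are so. -/
structure Setup (n : ℕ) (f : Mem) (s : Mem) : Prop where
  inp : ∀ z, 0 ≤ z → s z = f z
  n : mget s 5 0 = n
  dig : ∀ j : ℕ, mget s 2 j = 0
  carry : mget s 0 7 = 0

theorem Setup.mset {s : Mem} {a k : ℤ} (h : Setup n f s) (v : ℤ) (hk : 0 ≤ k)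
    (ha : (a = 0 ∧ k ≠ 7) ∨ a = 1 ∨ (a = 5 ∧ k ≠ 0)) : Setup n f (mset s a k v) where
  inp z hz := by rw [mset_apply_of_nonneg _ _ (by omega) hk hz, h.inp z hz]
  n := by
    rcases ha with ⟨rfl, -⟩ | rfl | ⟨rfl, hk⟩
    · simpa using h.n
    · simpa using h.n
    · simpa [hk.symm] using h.n
  dig := by rcases ha with ⟨rfl, -⟩ | rfl | ⟨rfl, hk⟩ <;> simpa using h.dig
  carry := by
    rcases ha with ⟨rfl, hk⟩ | rfl | ⟨rfl, hk⟩
    · simpa [hk.symm] using h.carry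
    · simpa using h.carry
    · simpa using h.carry

/-- `m` is the least of `k` and the ceiling of `1 / ε`, where `ε = a / b`. -/
structure Guess (a b : ℤ) (k m : ℕ) : Prop where
  le : m ≤ k
  pos : 0 < k → 1 ≤ m
  lt : 1 ≤ m → (m - 1) * a < b
  ge : m = k ∨ b ≤ m * a

theorem Guess.zero (a b : ℤ) : Guess a b 0 0 := ⟨le_rfl, by simp, by simp, .inl rfl⟩

theorem Guess.succ_of_lt {a b : ℤ} {k : ℕ} (h : k * a < b) : Guess a b (k + 1) (k + 1) :=
  ⟨le_rfl, fun _ => by omega, fun _ => by simpa using h, .inl rfl⟩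

theorem Guess.succ_of_ge {a b : ℤ} {k m : ℕ} (hb : 0 < b) (hg : Guess a b k m) (h : b ≤ k * a) :
    Guess a b (k + 1) m := by
  refine ⟨hg.le.trans (by omega), fun _ => hg.pos ?_, hg.lt, .inr ?_⟩
  · rcases Nat.eq_zero_or_pos k with rfl | hk
    · simp at h; omega
    · exact hk
  · rcases hg.ge with rfl | h'
    · exact h
    · exact h'

variable {s : Mem}

theorem three_mul_le (h : ValidInput n f G) (hM : 16 * G ^ 4 ≤ M) : 3 * n + 8 ≤ M ∧ G ≤ M := by
  have h1 := h.one_le_bound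
  have h2 : G ≤ G ^ 4 := le_self_pow₀ h1 (by norm_num)
  have h3 := h.n_le
  omega

theorem runs_guessProg (h : ValidInput n f G) (hM : 16 * G ^ 4 ≤ M) (hs : Setup n f s)
    (hm : mget s 5 1 = 0) (hA : ∀ e : ℕ, mget s 1 e = 0) :
    Runs M guessProg s (4 * n + 2) fun s' => Setup n f s' ∧ (∀ e : ℕ, mget s' 1 e = 0) ∧
      ∃ m : ℕ, mget s' 5 1 = m ∧ Guess (f 0) (f 1) n m := by
  have hle := three_mul_le h hM
  refine Runs.mono (T₁ := n * (2 + 2) + 2) ?_ (by omega) fun _ h => h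
  refine Runs.forTo (fun i s => Setup n f s ∧ (∀ e : ℕ, mget s 1 e = 0) ∧
      ∃ m : ℕ, mget s 5 1 = m ∧ Guess (f 0) (f 1) i m) n
    (by decide) (by decide) (by omega) (fun i s h => by simp [nE, h.1.n]) ?_ ?_ ?_ (fun _ h => h)
  · rintro i s x ⟨h1, h2, h3⟩
    exact ⟨h1.mset _ le_rfl (by simp), by simpa using h2, by simpa using h3⟩
  · exact ⟨hs, hA, 0, by simpa using hm, Guess.zero _ _⟩
  · rintro i hi s hv ⟨h1, h2, m, h3, h4⟩
    have he : (Expr.sub (.cell (.const 1)) (.mul (var 0) (.cell (.const 0)))).eval s =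
        f 1 - i * f 0 := by
      simp [hv, h1.inp]
    refine Runs.ite (T := 1) (by decide) (fun hpos => ?_) (fun hpos => ?_)
    · rw [he] at hpos
      refine Runs.wr (k := 1) (v := i + 1) (by decide) rfl (by simp [hv])
        (by rw [abs_of_nonneg (by omega)]; omega) ⟨by simpa using hv,
        h1.mset _ (by norm_num) (by simp), by simpa using h2, i + 1, by simp,
        Guess.succ_of_lt (by linarith)⟩
    · rw [he] at hpos
      exact Runs.skip ⟨hv, h1, h2, m, h3, h4.succ_of_ge h.epsDen_pos (by linarith)⟩

theorem runs_factorProg (h : ValidInput n f G) (hM : 16 * G ^ 4 ≤ M) (hs : Setup n f s)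
    (hm : mget s 5 1 = m) (hA : ∀ e : ℕ, mget s 1 e = 0) :
    Runs M factorProg s (9 * n + 3) fun s' => (Setup n f s' ∧ mget s' 5 1 = m) ∧
      (∀ e : ℕ, mget s' 1 e = 0) ∧ mget s' 0 8 = scaleFactor n f := by
  have hle := three_mul_le h hM
  have hG := h.one_le_bound
  refine Runs.mono (T₁ := (3 * n) * (1 + 2) + 2 + 1)
    (Runs.setVar_seq 1 (by decide) rfl (by simp; omega) ?_) (by omega) fun _ h => h
  refine Runs.forTo (fun i s => (Setup n f s ∧ mget s 5 1 = m) ∧ (∀ e : ℕ, mget s 1 e = 0) ∧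
      mget s 0 8 = ∏ e ∈ Finset.range i, denom f e) (3 * n)
    (by decide) (by decide) (by omega) (fun i s h => by simp [entriesE, nE, h.1.1.n]) ?_ ?_ ?_
    (fun _ h => h)
  · rintro i s x ⟨⟨h1, h2⟩, h3, h4⟩
    exact ⟨⟨h1.mset _ le_rfl (by simp), by simpa using h2⟩, by simpa using h3, by simpa using h4⟩
  · exact ⟨⟨hs.mset _ (by norm_num) (by simp), by simpa using hm⟩, by simpa using hA, by simp⟩
  · rintro i hi s hv ⟨⟨h1, h2⟩, h3, h4⟩
    have hd : (Expr.cell (denAdr (var 0))).eval s = denom f i := by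
      simp only [denAdr, eval_cell, eval_add, eval_mul, eval_const, eval_var, hv]
      exact h1.inp _ (by omega)
    have hb := h.prod_denom_le (j := i + 1) (by omega)
    refine Runs.setVar (∏ e ∈ Finset.range (i + 1), denom f e) (by decide) ?_
      (by rw [abs_of_nonneg (by omega)]; omega) ⟨by simpa using hv,
      ⟨h1.mset _ (by norm_num) (by simp), by simpa using h2⟩, by simpa using h3, by simp⟩
    rw [eval_mul, hd, eval_var, h4, Finset.prod_range_succ]

theorem runs_entryProg (h : ValidInput n f G) (hM : 16 * G ^ 4 ≤ M) (hs : Setup n f s)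
    (hm : mget s 5 1 = m) (hA : ∀ e : ℕ, mget s 1 e = 0) (h8 : mget s 0 8 = scaleFactor n f) :
    Runs M entryProg s (3 * n * (12 * n + 5) + 2) fun s' => (Setup n f s' ∧ mget s' 5 1 = m ∧
      mget s' 0 8 = scaleFactor n f) ∧
      ∀ e : ℕ, mget s' 1 e = if e < 3 * n then partialEntry f e (3 * n) else 0 := by
  have hle := three_mul_le h hM
  have hG := h.one_le_bound
  have hG2 : G ^ 2 ≤ M := by
    have h1 : G ^ 2 ≤ G ^ 4 := pow_le_pow_right₀ hG (by norm_num)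
    have h2 : 0 ≤ G ^ 4 := by positivity
    linarith
  have hbound : ∀ {e j : ℕ}, e < 3 * n → j ≤ 3 * n → |partialEntry f e j| ≤ M := fun he hj => by
    rw [abs_of_nonneg (h.partialEntry_nonneg he hj)]
    exact (h.partialEntry_le hj).trans hG2
  refine Runs.mono (T₁ := (3 * n) * ((3 * n) * (2 + 2) + 2 + 1 + 2) + 2) ?_ (le_of_eq (by ring))
    fun _ h => h
  refine Runs.forTo (fun i s => (Setup n f s ∧ mget s 5 1 = m ∧ mget s 0 8 = scaleFactor n f) ∧
      ∀ e : ℕ, mget s 1 e = if e < i then partialEntry f e (3 * n) else 0) (3 * n)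
    (by decide) (by decide) (by omega) (fun i s h => by simp [entriesE, nE, h.1.1.n]) ?_ ?_ ?_
    (fun _ h => h)
  · rintro i s x ⟨⟨h1, h2, h3⟩, h4⟩
    exact ⟨⟨h1.mset _ le_rfl (by simp), by simpa using h2, by simpa using h3⟩, by simpa using h4⟩
  · exact ⟨⟨hs, hm, h8⟩, by simpa using hA⟩
  · rintro i hi s hv ⟨⟨h1, h2, h3⟩, h4⟩
    have hnum : (Expr.cell (numAdr (var 0))).eval s = partialEntry f i 0 := by
      simp only [numAdr, eval_cell, eval_add, eval_mul, eval_const, eval_var, hv]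
      rw [h1.inp _ (by omega)]
      simp [partialEntry, numer]
    refine Runs.wr_seq i (partialEntry f i 0) (by decide) (by simp [hv]) hnum
      (hbound hi (by omega)) ?_
    refine Runs.forTo (fun j s => (mget s 0 0 = i ∧ Setup n f s ∧ mget s 5 1 = m ∧
        mget s 0 8 = scaleFactor n f) ∧ ∀ e : ℕ, mget s 1 e = if e < i then
        partialEntry f e (3 * n) else if e = i then partialEntry f e j else 0) (3 * n)
      (by decide) (by decide) (by omega) (fun i s h => by simp [entriesE, nE, h.1.2.1.n])
      ?_ ?_ ?_ ?_
    · rintro i s x ⟨⟨h0, h1, h2, h3⟩, h4⟩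
      exact ⟨⟨by simpa using h0, h1.mset _ (by norm_num) (by simp), by simpa using h2,
        by simpa using h3⟩, by simpa using h4⟩
    · refine ⟨⟨by simpa using hv, h1.mset _ (by omega) (by simp), by simpa using h2,
        by simpa using h3⟩, fun e => ?_⟩
      simp only [mget_mset, Nat.cast_inj, h4]
      split_ifs with h5 h6 <;> first | rfl | omega | rw [h5]
    · rintro j hj s hj9 ⟨⟨h0, h1, h2, h3⟩, h4⟩
      have hd : (Expr.cell (denAdr (var 9))).eval s = denom f j := by
        simp only [denAdr, eval_cell, eval_add, eval_mul, eval_const, eval_var, hj9]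
        exact h1.inp _ (by omega)
      have he : (Expr.mul (.sub (var 9) (var 0)) (.sub (var 9) (var 0))).eval s =
          ((j : ℤ) - i) * (j - i) := by simp [h0, hj9]
      have hi1 : mget s 1 i = partialEntry f i j := by rw [h4]; simp
      refine Runs.ite (T := 1) (by decide) (fun hpos => ?_) (fun hpos => ?_)
      · rw [he] at hpos
        have hne : j ≠ i := by rintro rfl; simp at hpos
        refine Runs.wr (k := i) (v := partialEntry f i (j + 1)) (by decide) (by simp [h0]) ?_
          (hbound hi (by omega)) ⟨by simpa using hj9, ⟨by simpa using h0,
          h1.mset _ (by omega) (by simp), by simpa using h2, by simpa using h3⟩, fun e => ?_⟩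
        · rw [eval_mul, hd, eval_rd, eval_var, h0, hi1, partialEntry, partialEntry,
            Finset.prod_range_succ, if_neg hne, mul_assoc]
        · simp only [mget_mset, Nat.cast_inj, h4]
          split_ifs with h5 h6 <;> first | rfl | omega | rw [h5]
      · rw [he] at hpos
        have hji : j = i := by
          by_contra hne
          have : (j : ℤ) - i ≠ 0 := by omega
          exact hpos (mul_self_pos.2 this)
        refine Runs.skip ⟨hj9, ⟨h0, h1, h2, h3⟩, fun e => ?_⟩
        rw [h4]
        refine if_congr Iff.rfl rfl ?_
        split_ifs with h5
        · rw [partialEntry, partialEntry, Finset.prod_range_succ, h5, hji, if_pos rfl, mul_one]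
        · rfl
    · rintro s ⟨⟨h0, h1, h2, h3⟩, h4⟩
      refine ⟨h0, ⟨h1, h2, h3⟩, fun e => ?_⟩
      rw [h4]
      split_ifs <;> first | rfl | omega

theorem runs_initProg (h : ValidInput n f G) (hM : 16 * G ^ 4 ≤ M) (hs : Setup n f s)
    (hm : mget s 5 1 = m) (h8 : mget s 0 8 = scaleFactor n f)
    (hA : ∀ e : ℕ, mget s 1 e = if e < 3 * n then partialEntry f e (3 * n) else 0) :
    Runs M initProg s 5 fun s' => (∃ β, (scaled n m f).Ctx β (-1) s') ∧
      (∀ j : ℕ, mget s' 2 j = 0) ∧ mget s' 0 7 = 0 := by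
  have hle := three_mul_le h hM
  have hG := h.one_le_bound
  have h1M : |(1 : ℤ)| ≤ M := by simp; omega
  have hn : entriesE.eval s = 3 * n := by simp [entriesE, nE, hs.n]
  have hthr : |f 3 * scaleFactor n f * scaleFactor n f| ≤ M := by
    rw [abs_mul, abs_mul]
    have h1 := h.abs_le 3
    have h2 : |scaleFactor n f| ≤ G := by
      rw [abs_of_nonneg (by have := (h.prod_denom_le le_rfl).1; rw [scaleFactor]; omega)]
      exact h.prod_le
    have h3 : |f 3| * |scaleFactor n f| * |scaleFactor n f| ≤ G * G * G :=
      mul_le_mul (mul_le_mul h1 h2 (abs_nonneg _) (by omega)) h2 (abs_nonneg _) (by positivity)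
    have h4 : G ^ 3 ≤ G ^ 4 := pow_le_pow_right₀ hG (by norm_num)
    have h5 : 0 ≤ G ^ 4 := by positivity
    linarith
  refine Runs.wr_seq (3 * n + 1) 1 (by decide) (by simp [hn]) rfl h1M ?_
  have hs1 := hs.mset (a := 1) (k := 3 * n + 1) 1 (by omega) (by simp)
  refine Runs.wr_seq (3 * n + 3) 1 (by decide) (by simp [entriesE, nE, hs1.n]) rfl h1M ?_
  have hs2 := hs1.mset (a := 1) (k := 3 * n + 3) 1 (by omega) (by simp)
  refine Runs.wr_seq 2 (f 3 * scaleFactor n f * scaleFactor n f) (by decide) rfl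
    (by simp [hs2.inp, h8]) hthr ?_
  have hs3 := hs2.mset (a := 5) (k := 2) (f 3 * scaleFactor n f * scaleFactor n f)
    (by norm_num) (by simp)
  refine Runs.wr_seq 3 (f 4) (by decide) rfl (by simp [hs3.inp]) ((h.abs_le 4).trans hle.2) ?_
  have hs4 := hs3.mset (a := 5) (k := 3) (f 4) (by norm_num) (by simp)
  refine Runs.setVar (-1) (by decide) rfl (by simpa using h1M) ?_
  have hs5 := hs4.mset (a := 0) (k := 6) (-1) (by norm_num) (by simp)
  refine ⟨⟨fun k => mget _ 4 k, ⟨?_, fun _ => rfl, by simp⟩⟩, hs5.dig, hs5.carry⟩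
  set s' := mset (mset (mset (mset (mset s 1 (3 * n + 1) 1) 1 (3 * n + 3) 1) 5 2
    (f 3 * scaleFactor n f * scaleFactor n f)) 5 3 (f 4)) 0 6 (-1) with hs'
  have hE : ∀ e : ℕ, mget s' 1 e = entry n f e := by
    intro e
    have : mget s' 1 e = mget (mset (mset s 1 (3 * n + 1) 1) 1 (3 * n + 3) 1) 1 e := by
      simp [hs']
    rw [this, mget_mset, mget_mset, hA, entry]
    split_ifs <;> first | rfl | omega
  constructor
  · exact hs5.n
  · simpa [hs', scaled] using hm
  · simp [hs', scaled]
  · simp [hs', scaled]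
  · exact fun k => by simpa [scaled] using hE (3 * k)
  · exact fun k => by simpa [scaled] using hE (3 * k + 1)
  · exact fun k => by simpa [scaled] using hE (3 * k + 2)

theorem runs_setupProg (h : ValidInput n f G) (hM : 16 * G ^ 4 ≤ M) :
    Runs M setupProg f (36 * n ^ 2 + 28 * n + 13) fun s' => ∃ m, Guess (f 0) (f 1) n m ∧
      (∃ β, (scaled n m f).Ctx β (-1) s') ∧ (∀ j : ℕ, mget s' 2 j = 0) ∧ mget s' 0 7 = 0 := by
  have hz : ∀ a k : ℤ, 0 ≤ a → 0 ≤ k → mget f a k = 0 := fun a k ha hk => h.neg _ (by omega)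
  refine Runs.mono (T₁ := ((4 * n + 2) + ((9 * n + 3) + ((3 * n * (12 * n + 5) + 2) + 5))) + 1)
    (Runs.wr_seq 0 n (by decide) rfl h.n_eq ?_ ?_) (by nlinarith) fun _ h => h
  · rw [← h.n_eq]; exact (h.abs_le 2).trans (three_mul_le h hM).2
  have hs : Setup n f (mset f 5 0 n) := ⟨fun z hz =>
    mset_apply_of_nonneg _ _ (by norm_num) le_rfl hz,
    by simp, fun j => by simpa using hz 2 j (by norm_num) (by omega),
    by simpa using hz 0 7 (by norm_num) (by norm_num)⟩
  refine Runs.seq ((runs_guessProg h hM hs (by simpa using hz 5 1 (by norm_num) (by norm_num))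
    fun e => by simpa using hz 1 e (by norm_num) (by omega)).mono le_rfl ?_)
  rintro s1 ⟨h1, h2, m, h3, h4⟩
  refine Runs.seq ((runs_factorProg h hM h1 h3 h2).mono le_rfl ?_)
  rintro s2 ⟨⟨h5, h6⟩, h7, h8⟩
  refine Runs.seq ((runs_entryProg h hM h5 h6 h7 h8).mono le_rfl ?_)
  rintro s3 ⟨⟨h9, h10, h11⟩, h12⟩
  exact (runs_initProg h hM h9 h10 h11 h12).mono le_rfl fun s4 h13 => ⟨m, h4, h13⟩

theorem runs_outputProg {D : Scaled} {β : ℕ → ℤ} {b : ℤ} (hs : D.Ctx β b s)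
    (hle : D.n ≤ M) (hβ : ∀ k < D.n, |β k| ≤ M) :
    Runs M outputProg s (3 * D.n + 2) fun s' => ∀ k < D.n, s' k = β k := by
  refine Runs.mono (T₁ := D.n * (1 + 2) + 2) ?_ (by omega) fun _ h => h
  refine Runs.forTo (fun i s => (mget s 5 0 = D.n ∧ ∀ k : ℕ, mget s 4 k = β k) ∧
      ∀ k < i, s k = β k) D.n
    (by decide) (by decide) hle (fun i s h => by simp [nE, h.1.1]) ?_ ?_ ?_ (fun _ h => h.2)
  · rintro i s x ⟨⟨h1, h2⟩, h3⟩
    refine ⟨⟨by simpa using h1, by simpa using h2⟩, fun k hk => ?_⟩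
    rw [mset_apply_of_nonneg _ _ le_rfl le_rfl (by omega), h3 k hk]
  · exact ⟨⟨hs.n, hs.best⟩, by simp⟩
  · rintro i hi s hv ⟨⟨h1, h2⟩, h3⟩
    have hi0 : (0 : ℤ) ≤ i := by omega
    refine Runs.store (k := i) (v := β i) (by decide) (by simp [hv]) (by simp [hv, h2]) (hβ i hi)
      ⟨?_, ⟨?_, fun k => ?_⟩, fun k hk => ?_⟩
    · rw [mget_update_of_nonneg _ _ le_rfl le_rfl hi0, hv]
    · rw [mget_update_of_nonneg _ _ (by norm_num) le_rfl hi0, h1]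
    · rw [mget_update_of_nonneg _ _ (by norm_num) (by omega) hi0, h2]
    · rw [Function.update_apply]
      split_ifs with hki
      · rw [Nat.cast_inj] at hki; rw [hki]
      · exact h3 k (by omega)

/-- The whole run: the output is the indicator vector of a feasible set that is at least as cheap as
every feasible candidate, provided that some candidate is feasible. -/
theorem runs_schemeProg (h : ValidInput n f G) (hM : 16 * G ^ 4 ≤ M)
    (hgood : ∀ m, Guess (f 0) (f 1) n m → ∃ t : ℕ → ℕ, (∀ j, t j < n + 2) ∧
      (scaled n m f).Feas ((scaled n m f).candSet t)) :
    ∃ m, Guess (f 0) (f 1) n m ∧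
    ∃ t s', Exec schemeProg f t s' ∧ t ≤ (n ^ 2 * (n + 2) ^ (m + 6) * 200) * (unit * width M) ∧
      ∃ X ⊆ Finset.range n, (scaled n m f).Feas X ∧ (∀ k < n, s' k = ind (k ∈ X)) ∧
        ∀ t : ℕ → ℕ, (∀ j, t j < n + 2) → (scaled n m f).Feas ((scaled n m f).candSet t) →
          ∑ k ∈ X, (scaled n m f).c k ≤
            ∑ k ∈ (scaled n m f).candSet t, (scaled n m f).c k := by
  have hG := h.one_le_bound
  have hle := three_mul_le h hM
  have hbdd : Bounded M f := fun z => (h.abs_le z).trans hle.2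
  obtain ⟨t1, s1, he1, ht1, hb1, m, hg, ⟨β, hctx⟩, hdig, hcarry⟩ := runs_setupProg h hM hbdd
  obtain ⟨t2, s2, he2, ht2, hb2, β', b', hctx', hbest⟩ :=
    Scaled.runs_searchProg h.proper (h.fits hg.le hM) hctx hdig hcarry hb1
  obtain ⟨t, ht, htf⟩ := hgood m hg
  have hb0 := (hbest.le _ ⟨t, ht, rfl⟩ htf).1
  rcases hbest.attained with hneg | ⟨X, hX, hXf, hXb, hXβ⟩
  · omega
  obtain ⟨t3, s3, he3, ht3, hb3, hout⟩ := runs_outputProg hctx' (by simp only [scaled]; omega)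
    (fun k hk => by rw [hXβ k hk]; exact (abs_ind_le _).trans (by omega)) hb2
  refine ⟨m, hg, t1 + (t2 + t3), s3, .seq he1 (.seq he2 he3), ?_, X, hX, hXf, fun k hk => by
    rw [hout k hk, hXβ k hk], fun t ht htf => hXb ▸ (hbest.le _ ⟨t, ht, rfl⟩ htf).2⟩
  simp only [scaled] at ht2 ht3
  have hT : (36 * n ^ 2 + 28 * n + 13) + (((n + 2) ^ (m + 6) * (15 * n + 8 * m + 50) + 1) +
      (3 * n + 2)) ≤ n ^ 2 * (n + 2) ^ (m + 6) * 200 := by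
    have hn := h.n_pos
    have hm := hg.le
    have h1 : 15 * n + 8 * m + 50 ≤ 73 * n ^ 2 := by nlinarith
    have h2 : (n + 2) ^ (m + 6) * (15 * n + 8 * m + 50) ≤ (n + 2) ^ (m + 6) * (73 * n ^ 2) :=
      Nat.mul_le_mul_left _ h1
    have h3 : 36 * n ^ 2 + 28 * n + 13 + 1 + (3 * n + 2) ≤ 83 * n ^ 2 := by nlinarith
    have h4 : n ^ 2 * 1 ≤ n ^ 2 * (n + 2) ^ (m + 6) :=
      Nat.mul_le_mul_left _ (Nat.one_le_pow _ _ (by omega))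
    nlinarith
  refine le_trans ?_ (Nat.mul_le_mul_right _ hT)
  simp only [add_mul] at ht1 ht2 ht3 ⊢
  omega

end MinCKP

namespace MinCKP

variable {n : ℕ} {ε : ℚ} (I : Instance n)

/-! ### Instances and their scaled versions -/

theorem load_input_item (i : Fin n) {r : ℕ} (hr : r < 6) {z : ℤ} (hz : z = 6 * i + r + 5) :
    load (input ε I) z = (itemList I i).getD r 0 := by
  have h : z = ((6 * i + r + 5 : ℕ) : ℤ) := by push_cast; exact hz
  rw [h, load, if_pos (by omega), Int.toNat_natCast, input_getD ε I i hr]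

theorem numer_input (i : Fin n) {r : ℕ} (hr : r < 3) :
    numer (load (input ε I)) (3 * i + r) = (itemList I i).getD (2 * r) 0 :=
  load_input_item I i (by omega) (by push_cast; ring)

theorem denom_input (i : Fin n) {r : ℕ} (hr : r < 3) :
    denom (load (input ε I)) (3 * i + r) = (itemList I i).getD (2 * r + 1) 0 :=
  load_input_item I i (by omega) (by push_cast; ring)

theorem exists_entry_index {e : ℕ} (he : e < 3 * n) : ∃ i : Fin n, ∃ r < 3, e = 3 * i + r :=
  ⟨⟨e / 3, by omega⟩, e % 3, Nat.mod_lt _ (by norm_num), by simp only; omega⟩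

theorem denom_input_pos {e : ℕ} (he : e < 3 * n) : 1 ≤ denom (load (input ε I)) e := by
  obtain ⟨i, r, hr, rfl⟩ := exists_entry_index he
  rw [denom_input I i hr]
  interval_cases r
  · simpa [itemList] using Nat.succ_le_of_lt (I.p i).den_pos
  · simpa [itemList] using Nat.succ_le_of_lt (I.q i).den_pos
  · simpa [itemList] using Nat.succ_le_of_lt (I.c i).den_pos

theorem validInput (hε : 0 < ε) (hn : 0 < n) :
    ValidInput n (load (input ε I)) (2 ^ bitLength (input ε I)) where
  eps_pos := by simpa [load, input, encodeRat] using hε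
  epsDen_pos := by simpa [load, input, encodeRat] using ε.den_pos
  n_eq := by simp [load, input, encodeRat, Instance.encode]
  n_pos := hn
  thr_pos := by simpa [load, input, encodeRat, Instance.encode] using I.C_pos
  den_pos := by simpa [load, input, encodeRat, Instance.encode] using I.C.den_pos
  numer_nonneg e he := by
    obtain ⟨i, r, hr, rfl⟩ := exists_entry_index he
    rw [numer_input I i hr]
    interval_cases r
    · simpa [itemList] using I.p_nonneg i
    · simpa [itemList] using I.q_nonneg i
    · simpa [itemList] using I.c_nonneg i
  denom_pos e he := denom_input_pos I he
  abs_le z := abs_load_le _ _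
  prod_le := by
    have h : ∀ e : ℕ, denom (load (input ε I)) e = (input ε I).getD (6 + 2 * e) 0 := fun e => by
      rw [denom, load, if_pos (by omega)]
      congr 1
    have := prod_getD_le (input ε I) (3 * n) (fun e => 6 + 2 * e) (fun a b h => by simpa using h)
      (fun e he => by rw [length_input]; omega) fun e he => by
        rw [← h]; exact zero_le_one.trans (denom_input_pos I he)
    simpa [scaleFactor, h] using this
  neg z hz := by rw [load, if_neg (by omega)]

/-- The 0/1-vector of a set of items. -/
def toVec (n : ℕ) (X : Finset ℕ) : Fin n → Bool := fun i => decide ((i : ℕ) ∈ X)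

theorem sum_eq_dot {v : Fin n → ℚ} {g : ℕ → ℤ} {μ : ℚ} (h : ∀ i : Fin n, (g i : ℚ) = v i * μ)
    {X : Finset ℕ} (hX : X ⊆ Finset.range n) :
    ((∑ k ∈ X, g k : ℤ) : ℚ) = dot v (toVec n X) * μ := by
  have h1 : ∑ k ∈ X, g k = ∑ k ∈ Finset.range n, if k ∈ X then g k else 0 := by
    rw [Finset.sum_ite_mem, Finset.inter_eq_right.2 hX]
  rw [h1, Finset.sum_range, dot, Finset.sum_mul]
  push_cast
  refine Finset.sum_congr rfl fun i _ => ?_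
  by_cases hi : (i : ℕ) ∈ X
  · simp [toVec, hi, h]
  · simp [toVec, hi]

theorem entry_eq (hε : 0 < ε) (i : Fin n) {r : ℕ} (hr : r < 3) :
    (entry n (load (input ε I)) (3 * i + r) : ℚ) =
      (itemList I i).getD (2 * r) 0 / (itemList I i).getD (2 * r + 1) 0 *
        scaleFactor n (load (input ε I)) := by
  have hv := validInput I hε (Nat.zero_lt_of_lt i.2)
  have he : 3 * (i : ℕ) + r < 3 * n := by omega
  have h1 := partialEntry_mul_denom (f := load (input ε I)) he
  have h2 := hv.denom_pos _ he
  rw [numer_input I i hr, denom_input I i hr] at h1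
  rw [denom_input I i hr] at h2
  have h3 : (((itemList I i).getD (2 * r + 1) 0 : ℤ) : ℚ) ≠ 0 := by
    exact_mod_cast (by omega : (itemList I i).getD (2 * r + 1) 0 ≠ 0)
  rw [entry, if_pos he, div_mul_eq_mul_div, eq_div_iff h3]
  exact_mod_cast h1

variable (m : ℕ)

/-- The scaled version of an instance. -/
noncomputable def Instance.scaled (ε : ℚ) : Scaled := MinCKP.scaled n m (load (input ε I))

variable {X : Finset ℕ}

theorem scaleFactor_input_pos (hε : 0 < ε) (hn : 0 < n) :
    (0 : ℚ) < scaleFactor n (load (input ε I)) := by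
  have := ((validInput I hε hn).prod_denom_le le_rfl).1
  exact_mod_cast (by rw [scaleFactor]; omega : 0 < scaleFactor n (load (input ε I)))

theorem sum_p_eq (hε : 0 < ε) (hX : X ⊆ Finset.range n) :
    ((∑ k ∈ X, (I.scaled m ε).p k : ℤ) : ℚ) =
      dot I.p (toVec n X) * scaleFactor n (load (input ε I)) :=
  sum_eq_dot (fun i => (entry_eq I hε i (r := 0) (by norm_num)).trans (by
    simp [itemList, Rat.num_div_den])) hX

theorem sum_q_eq (hε : 0 < ε) (hX : X ⊆ Finset.range n) :
    ((∑ k ∈ X, (I.scaled m ε).q k : ℤ) : ℚ) =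
      dot I.q (toVec n X) * scaleFactor n (load (input ε I)) :=
  sum_eq_dot (fun i => (entry_eq I hε i (r := 1) (by norm_num)).trans (by
    simp [itemList, Rat.num_div_den])) hX

theorem sum_c_eq (hε : 0 < ε) (hX : X ⊆ Finset.range n) :
    ((∑ k ∈ X, (I.scaled m ε).c k : ℤ) : ℚ) =
      I.cost (toVec n X) * scaleFactor n (load (input ε I)) :=
  sum_eq_dot (fun i => (entry_eq I hε i (r := 2) (by norm_num)).trans (by
    simp [itemList, Rat.num_div_den])) hX

theorem feas_iff (hε : 0 < ε) (hn : 0 < n) (hX : X ⊆ Finset.range n) :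
    (I.scaled m ε).Feas X ↔ I.Feasible (toVec n X) := by
  have hμ := scaleFactor_input_pos I hε hn
  have hp := sum_p_eq I m hε hX
  have hq := sum_q_eq I m hε hX
  set μ := scaleFactor n (load (input ε I)) with hμ_def
  have hthr : (I.scaled m ε).thr = I.C.num * μ * μ := by
    simp [Instance.scaled, scaled, load, input, encodeRat, Instance.encode, hμ_def]
  have hden : (I.scaled m ε).den = I.C.den := by
    simp [Instance.scaled, scaled, load, input, encodeRat, Instance.encode]
  have hd : (0 : ℚ) < I.C.den := by exact_mod_cast I.C.den_pos
  have hC : (I.C.num : ℚ) = I.C * I.C.den := (Rat.mul_den_eq_num I.C).symm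
  rw [Scaled.Feas, ← Int.cast_le (R := ℚ), hthr, hden]
  push_cast at hp hq ⊢
  rw [hp, hq, hC, Instance.Feasible]
  have e1 : I.C * I.C.den * μ * μ = I.C * (I.C.den * μ * μ) := by ring
  have e2 : (I.C.den : ℚ) * ((dot I.p (toVec n X) * μ) ^ 2 + (dot I.q (toVec n X) * μ) ^ 2) =
      (dot I.p (toVec n X) ^ 2 + dot I.q (toVec n X) ^ 2) * (I.C.den * μ * μ) := by ring
  rw [e1, e2, mul_le_mul_iff_left₀ (by positivity)]

theorem exists_isOpt (hI : ∃ y, I.Feasible y) :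
    ∃ O ⊆ Finset.range n, I.Feasible (toVec n O) ∧ I.IsOpt (I.cost (toVec n O)) := by
  classical
  obtain ⟨y, hy, hmin⟩ := Finset.exists_min_image
    (Finset.univ.filter fun y : Fin n → Bool => I.Feasible y) I.cost
    (by obtain ⟨y, hy⟩ := hI; exact ⟨y, by simpa using hy⟩)
  have hvec : toVec n
      ((Finset.univ.filter fun i : Fin n => y i = true).map Fin.valEmbedding) = y := by
    funext i
    simp only [toVec, Finset.mem_map, Finset.mem_filter, Finset.mem_univ, true_and,
      Fin.valEmbedding_apply]
    by_cases h : y i = true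
    · rw [h, decide_eq_true_iff]
      exact ⟨i, h, rfl⟩
    · rw [Bool.not_eq_true] at h
      rw [h, decide_eq_false_iff_not]
      rintro ⟨j, hj, hji⟩
      rw [Fin.ext hji, h] at hj
      simp at hj
  refine ⟨_, ?_, hvec ▸ (Finset.mem_filter.1 hy).2, ?_⟩
  · intro k hk
    obtain ⟨i, -, rfl⟩ := Finset.mem_map.1 hk
    simp
  · rw [hvec]
    refine ⟨⟨y, (Finset.mem_filter.1 hy).2, rfl⟩, ?_⟩
    rintro w ⟨z, hz, rfl⟩
    exact hmin z (by simpa using hz)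

/-- The candidate built from an optimal solution is feasible and nearly optimal. -/
theorem exists_good_candidate (hε : 0 < ε) (hn : 0 < n) {O : Finset ℕ} (hO : O ⊆ Finset.range n)
    (hOf : I.Feasible (toVec n O)) (hm : Guess ε.num ε.den n m) :
    ∃ t : ℕ → ℕ, (∀ j, t j < n + 2) ∧ (I.scaled m ε).Feas ((I.scaled m ε).candSet t) ∧
      I.cost (toVec n ((I.scaled m ε).candSet t)) ≤ (1 + ε) * I.cost (toVec n O) := by
  have hv := validInput I hε hn
  have hD : (I.scaled m ε).Proper := hv.proper
  have hμ := scaleFactor_input_pos I hε hn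
  have hOf' := (feas_iff I m hε hn hO).2 hOf
  have hden : 0 < (I.scaled m ε).den := hv.den_pos
  have hthr : 0 < (I.scaled m ε).thr := by
    have h1 := hv.thr_pos
    have h2 : 0 < scaleFactor n (load (input ε I)) := by exact_mod_cast hμ
    exact mul_pos (mul_pos h1 h2) h2
  set D := I.scaled m ε
  set x := ∑ k ∈ O, D.p k with hx
  set y := ∑ k ∈ O, D.q k with hy
  have hx0 : 0 ≤ x := Finset.sum_nonneg fun k _ => hD.p_nonneg k
  have hy0 : 0 ≤ y := Finset.sum_nonneg fun k _ => hD.q_nonneg k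
  have hxy : 0 < x + y := by
    by_contra! hcon
    have h1 : x = 0 := by omega
    have h2 : y = 0 := by omega
    rw [Scaled.Feas, ← hx, ← hy, h1, h2] at hOf'
    norm_num at hOf'
    omega
  obtain ⟨t, ht, hgain, hcost⟩ := Scaled.exists_candidate hD hO (hm.pos hn) hx hy hxy
  have hXn : D.candSet t ⊆ Finset.range n := Scaled.candSet_subset
  refine ⟨t, ht, ?_, ?_⟩
  · -- by the Cauchy–Schwarz inequality, reaching as far as `(x, y)` in its direction suffices
    refine le_trans hOf' (mul_le_mul_of_nonneg_left ?_ hden.le)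
    simp only [Scaled.gain, Finset.sum_add_distrib, ← Finset.mul_sum] at hgain
    rw [← hx, ← hy] at hgain ⊢
    nlinarith [sq_nonneg (∑ k ∈ D.candSet t, D.p k - x), sq_nonneg (∑ k ∈ D.candSet t, D.q k - y)]
  · have hcX := sum_c_eq I m hε hXn
    have hcO := sum_c_eq I m hε hO
    set μ := scaleFactor n (load (input ε I))
    have hcO0 : (0 : ℚ) ≤ ((∑ k ∈ O, D.c k : ℤ) : ℚ) := by
      exact_mod_cast Finset.sum_nonneg fun k _ => hD.c_nonneg k
    rw [← mul_le_mul_iff_left₀ hμ, mul_assoc, ← hcX, ← hcO]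
    rcases hcost with h | ⟨hmO, h⟩
    · have h' : ((∑ k ∈ D.candSet t, D.c k : ℤ) : ℚ) ≤ ((∑ k ∈ O, D.c k : ℤ) : ℚ) := by
        exact_mod_cast h
      nlinarith
    · have hcard : O.card ≤ n := by simpa using Finset.card_le_card hO
      have hmn : m ≠ n := by
        change m < O.card at hmO
        omega
      have hmε : 1 ≤ m * ε := by
        have h1 : (ε.den : ℤ) ≤ m * ε.num := hm.ge.resolve_left hmn
        have h2 : (0 : ℚ) < ε.den := by exact_mod_cast ε.den_pos
        have h3 : (ε.den : ℚ) ≤ m * ε.num := by exact_mod_cast h1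
        rw [← Rat.mul_den_eq_num ε, ← mul_assoc] at h3
        nlinarith
      have h' : (m : ℚ) * (((∑ k ∈ D.candSet t, D.c k : ℤ) : ℚ) - ((∑ k ∈ O, D.c k : ℤ) : ℚ)) ≤
          ((∑ k ∈ O, D.c k : ℤ) : ℚ) := by
        exact_mod_cast h
      generalize ((∑ k ∈ D.candSet t, D.c k : ℤ) : ℚ) = a at *
      generalize ((∑ k ∈ O, D.c k : ℤ) : ℚ) = o at *
      rcases le_total a o with hao | hao
      · nlinarith
      · nlinarith [mul_le_mul_of_nonneg_left h' hε.le,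
          mul_le_mul_of_nonneg_right hmε (sub_nonneg.2 hao)]

/-! ### The time bound -/

theorem add_two_pow_le (hn : 0 < n) {m : ℕ} (hm : m ≤ n) :
    ((n : ℝ) + 2) ^ m ≤ 9 * (n : ℝ) ^ m := by
  have hn' : (0 : ℝ) < n := by exact_mod_cast hn
  have h1 : (n : ℝ) + 2 = n * (2 / n + 1) := by field_simp; ring
  have h2 : (2 / (n : ℝ) + 1) ^ m ≤ Real.exp 2 := by
    calc (2 / (n : ℝ) + 1) ^ m ≤ (2 / (n : ℝ) + 1) ^ n :=
          pow_le_pow_right₀ (by have : 0 < 2 / (n : ℝ) := by positivity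
                                linarith) hm
      _ ≤ Real.exp (2 / n) ^ n := pow_le_pow_left₀ (by positivity) (Real.add_one_le_exp _) _
      _ = Real.exp 2 := by rw [← Real.exp_nat_mul]; congr 1; field_simp
  have h3 : Real.exp 2 ≤ 9 := by
    have h4 : Real.exp 2 = Real.exp 1 ^ 2 := by rw [← Real.exp_nat_mul]; norm_num
    have h5 := Real.exp_one_lt_d9
    have h6 := Real.exp_pos 1
    rw [h4]
    nlinarith
  rw [h1, mul_pow, mul_comm]
  exact mul_le_mul_of_nonneg_right (h2.trans h3) (by positivity)

theorem pow_guess_le (hε : 0 < ε) (hn : 0 < n) {m : ℕ} (hm : Guess ε.num ε.den n m) :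
    (n : ℝ) ^ m ≤ (n : ℝ) ^ (2 / (ε : ℝ) + 1) := by
  have hn' : (1 : ℝ) ≤ n := by exact_mod_cast hn
  have hε' : (0 : ℝ) < ε := by exact_mod_cast hε
  rw [← Real.rpow_natCast]
  refine Real.rpow_le_rpow_of_exponent_le hn' ?_
  have h1 : ((m : ℤ) - 1) * ε.num < ε.den := hm.lt (hm.pos hn)
  have h2 : ((m : ℝ) - 1) * ε ≤ 1 := by
    have h3 : (0 : ℚ) < ε.den := by exact_mod_cast ε.den_pos
    have h4 : ((m : ℚ) - 1) * ε.num < ε.den := by exact_mod_cast h1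
    rw [← Rat.mul_den_eq_num ε, ← mul_assoc] at h4
    have h5 : ((m : ℚ) - 1) * ε ≤ 1 := by nlinarith
    exact_mod_cast h5
  have h3 : (m : ℝ) - 1 ≤ 1 / ε := (le_div_iff₀ hε').2 h2
  have h4 : 1 / (ε : ℝ) ≤ 2 / ε := div_le_div_of_nonneg_right (by norm_num) hε'.le
  linarith

theorem width_le {L : ℕ} (hL : 1 ≤ L) : width (16 * (2 ^ L) ^ 4) ≤ 10 * L := by
  have h : 16 * (2 ^ L) ^ 4 = 2 ^ (4 * L + 4) := by
    rw [pow_add, ← pow_mul, mul_comm L 4]; norm_num; ring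
  rw [width, h, Nat.size_pow]
  omega

theorem one_le_bitLength_input (ε : ℚ) : 1 ≤ bitLength (input ε I) := by
  rw [input, bitLength_append]
  have := one_le_bits ε.num
  simp only [encodeRat, bitLength, List.map_cons, List.sum_cons]
  omega

end MinCKP

open MinCKP

theorem theorem1 :
    ∃ (A : RAM.Prog) (K a b : ℕ), ∀ (ε : ℚ), 0 < ε →
      ∀ (n : ℕ) (I : MinCKP.Instance n), (∃ y, I.Feasible y) →
        ∃ (t : ℕ) (s : RAM.Mem) (x : Fin n → Bool),
          RAM.Exec A (RAM.load (MinCKP.encodeRat ε ++ I.encode)) t s ∧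
          MinCKP.Holds s x ∧
          I.EpsOptimal ε x ∧
          (t : ℝ) ≤ K * (n : ℝ) ^ (2 / (ε : ℝ) + a) *
            ((RAM.bitLength I.encode + RAM.bitLength (MinCKP.encodeRat ε) : ℕ) : ℝ) ^ b := by
  -- `9 * 3 ^ 6` for the number of tuples, `200` steps for each and each pair of items, `2000` words
  -- for a step, and `10` for the ratio of the word length to the input length
  refine ⟨schemeProg, 9 * 3 ^ 6 * 200 * 2000 * 10, 9, 1, fun ε hε n I hI => ?_⟩
  have hn : 0 < n := by
    obtain ⟨y, hy⟩ := hI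
    rcases Nat.eq_zero_or_pos n with rfl | hn
    · have := I.C_pos
      simp only [Instance.Feasible, dot, Finset.univ_eq_empty, Finset.sum_empty] at hy
      norm_num at hy
      linarith
    · exact hn
  have hv := validInput I hε hn
  obtain ⟨O, hO, hOf, hopt⟩ := exists_isOpt I hI
  have hnum : load (input ε I) 0 = ε.num := by simp [load, input, encodeRat]
  have hden : load (input ε I) 1 = ε.den := by simp [load, input, encodeRat]
  set L := bitLength (input ε I) with hL
  obtain ⟨m, hm, t, s, hexec, ht, X, hX, hXf, hs, hbest⟩ :=
    runs_schemeProg (M := 16 * (2 ^ L) ^ 4) hv (by push_cast; exact le_rfl) fun m hm => by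
      rw [hnum, hden] at hm
      obtain ⟨t, ht, hf, -⟩ := exists_good_candidate I m hε hn hO hOf hm
      exact ⟨t, ht, hf⟩
  rw [hnum, hden] at hm
  refine ⟨t, s, toVec n X, hexec, fun i => ?_, ⟨(feas_iff I m hε hn hX).1 hXf, _, hopt, ?_⟩, ?_⟩
  · rw [hs i i.2]
    by_cases h : (i : ℕ) ∈ X
    · simp [ind, toVec, h]
    · simp [ind, toVec, h]
  · obtain ⟨t', ht', hf, hc⟩ := exists_good_candidate I m hε hn hO hOf hm
    refine le_trans ?_ hc
    have hμ := scaleFactor_input_pos I hε hn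
    rw [← mul_le_mul_iff_left₀ hμ, ← sum_c_eq I m hε hX,
      ← sum_c_eq I m hε Scaled.candSet_subset]
    exact_mod_cast hbest t' ht' hf
  · have hL' : bitLength I.encode + bitLength (encodeRat ε) = L := by
      rw [hL, input, bitLength_append, add_comm]
    rw [hL', pow_one]
    have hn' : (1 : ℝ) ≤ n := by exact_mod_cast hn
    have hw := width_le (one_le_bitLength_input I ε)
    have h1 : (t : ℝ) ≤ (n : ℝ) ^ 2 * ((n : ℝ) + 2) ^ (m + 6) * 200 * (2000 * (10 * L)) := by
      have : t ≤ n ^ 2 * (n + 2) ^ (m + 6) * 200 * (2000 * (10 * L)) :=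
        ht.trans (Nat.mul_le_mul_left _ (Nat.mul_le_mul_left _ hw))
      exact_mod_cast this
    have h2 : ((n : ℝ) + 2) ^ 6 ≤ 3 ^ 6 * (n : ℝ) ^ 6 := by
      rw [← mul_pow]; exact pow_le_pow_left₀ (by positivity) (by linarith) _
    have h3 : ((n : ℝ) + 2) ^ m ≤ 9 * (n : ℝ) ^ (2 / (ε : ℝ) + 1) :=
      (add_two_pow_le hn hm.le).trans
        (mul_le_mul_of_nonneg_left (pow_guess_le hε hn hm) (by norm_num))
    have h4 : (n : ℝ) ^ (2 / (ε : ℝ) + (9 : ℕ)) =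
        (n : ℝ) ^ (2 / (ε : ℝ) + 1) * ((n : ℝ) ^ 6 * (n : ℝ) ^ 2) := by
      rw [← pow_add, ← Real.rpow_add_natCast (by positivity)]
      congr 1
      push_cast
      ring
    have h5 : ((n : ℝ) + 2) ^ (m + 6) ≤
        9 * (n : ℝ) ^ (2 / (ε : ℝ) + 1) * (3 ^ 6 * (n : ℝ) ^ 6) := by
      rw [pow_add]
      exact mul_le_mul h3 h2 (by positivity) (by positivity)
    calc (t : ℝ) ≤ (n : ℝ) ^ 2 * ((n : ℝ) + 2) ^ (m + 6) * 200 * (2000 * (10 * L)) := h1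
      _ ≤ (n : ℝ) ^ 2 * (9 * (n : ℝ) ^ (2 / (ε : ℝ) + 1) * (3 ^ 6 * (n : ℝ) ^ 6)) * 200 *
          (2000 * (10 * L)) := by gcongr
      _ = _ := by rw [h4]; push_cast; ring
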